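/- Let $\mathcal C$ and $\mathcal S$ be finite sets (customer types and server types), let $\mathcal E\subset\mathcal C\times\mathcal S$ be such that the bipartite compatibility graph $(\mathcal C\sqcup\mathcal S,\mathcal E)$ is connected, and let $\alpha$, $\beta$ be probability distributions on $\mathcal C$, $\mathcal S$ with $\alpha_c>0$ and $\beta_s>0$ for all $c,s$. The types of the customers $c^1,c^2,\dots$ are i.i.d. with law $\alpha$, those of the servers $s^1,s^2,\dots$ are i.i.d. with law $\beta$, and the two sequences are independent. For $A\subset\mathcal C$ let $\mathcal S(A)$ be the set of server types compatible with some type in $A$. *Complete resource pooling* is the condition $$\sum_{c\in A}\alpha_c<\sum_{s\in\mathcal S(A)}\beta_s\qquad\text{for all } A\subset\mathcal C,\ A\neq\emptyset,\ A\neq\mathcal C .$$ Customers and servers, placed on two parallel lines, are matched first come first served (FCFS): each item is matched to the earliest compatible unmatched item of the other kind. *Exchanging* a matched pair means that the two items swap their positions, so that the server stands on the customer line and the customer on the server line. Consider the following Markov chains. *Natural chains.* (1) $O$ (pair by pair): after the FCFS matching of the first $N$ customers and first $N$ servers, the ordered lists of unmatched customers and of unmatched servers; in one step a new pair is added, each of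 the two is matched to the earliest compatible unmatched item if there is one, and the two are matched to each other if neither has an earlier match and they are compatible. (2) $Q^s$ (server by server): after the first $N$ servers have all been matched, the ordered list of the unmatched customers that precede the last matched customer; in one step the next server is matched to the first compatible unmatched customer. (3) $Q^c$ (customer by customer): the same with the roles of customers and servers interchanged. *Detailed chains* (matched pairs are exchanged). (4) $Z^s$ (server by server): the word of types of unmatched customers and of exchanged servers on the customer line, from the first unmatched customer to the last exchanged server (empty if the matching is perfect). (5) $Z^c$ (customer by customer): the same with the roles interchanged. (6) $D$ (pair by pair backward): after the FCFS matching of the first $N$ customers and first $N$ servers, the pair of words on the customer line from the first unmatched customer to position $N$, and on the server line from the first unmatched server to position $N$. (7) $E$ (pair by pair forward): after all customers and servers in positions $\le N$ have been matched, the pair of words on the customer line and on the server line, each from position $N+1$ to the last exchanged item; in one step the still unmatched items in position $N+1$ are matched. *Augmented chains* (server by server, with exchange). (8) $\mathcal Z$: the word on the customer line that ends with the last exchanged server and starts at the last position such that exchanged servers of all types occur in the word. (9) $\overline Z^s$: the minimal word on the customer line that contains all of $\mathcal Z$ and the first unmatched customer of each type. The state space of the chains (1)–(7) consists of all states accessible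 from the empty state, that of (8) and (9) of all states accessible from the states of a perfect matching, in which all customers up to the last exchanged server have been matched. A chain is *ergodic* if on its state space it is irreducible, aperiodic and positive recurrent (all mean return times are finite). Then each of these nine Markov chains is ergodic if and only if complete resource pooling holds. In particular, complete resource pooling is a necessary and sufficient condition for ergodicity of all the FCFS matching Markov chains. -/

import Mathlib

open scoped ENNReal

noncomputable section

/-! ### Countable state Markov chains -/

section MarkovChain

variable {σ : Type*}

/-- The `n`-step transition probabilities of the chain with one-step transition law `P`. -/
def nStep (P : σ → PMF σ) : ℕ → σ → PMF σ
  | 0, x => PMF.pure x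
  | n + 1, x => (P x).bind (nStep P n)

/-- `y` is accessible from `x`. -/
def Accessible (P : σ → PMF σ) : σ → σ → Prop :=
  Relation.ReflTransGen (fun x y => P x y ≠ 0)

/-- The state space of the chain: all states accessible from the states in `init`. -/
def stateSpace (P : σ → PMF σ) (init : Set σ) : Set σ :=
  {y | ∃ x ∈ init, Accessible P x y}

open Classical in
/-- `noVisit P x n y` is the probability that the chain started at `y` is not at `x`
at any of the times `1, …, n`, that is `P_y(T_x > n)`, `T_x = inf {k ≥ 1 : X_k = x}`. -/
def noVisit (P : σ → PMF σ) (x : σ) : ℕ → σ → ℝ≥0∞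
  | 0, _ => 1
  | n + 1, y => ∑' z, P y z * (if z = x then 0 else noVisit P x n z)

/-- The mean return time `E_x[T_x] = ∑_{n ≥ 0} P_x(T_x > n)`, possibly infinite. -/
def meanReturnTime (P : σ → PMF σ) (x : σ) : ℝ≥0∞ :=
  ∑' n, noVisit P x n x

/-- Ergodicity of the chain with transition law `P` on the set of all states accessible from
`init`: it is irreducible, aperiodic and positive recurrent. -/
structure IsErgodicChain (P : σ → PMF σ) (init : Set σ) : Prop where
  irreducible : ∀ x ∈ stateSpace P init, ∀ y ∈ stateSpace P init, Accessible P x y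
  /-- the greatest common divisor of the possible return times is one -/
  aperiodic : ∀ x ∈ stateSpace P init,
    ∀ d : ℕ, (∀ n, nStep P n x x ≠ 0 → d ∣ n) → d = 1
  positiveRecurrent : ∀ x ∈ stateSpace P init, meanReturnTime P x ≠ ∞

end MarkovChain

/-! ### Independent trials until a success -/

/-- The total weight of finite words of failures followed by a success is one. -/
theorem hasSum_failures {A : Type*} [Fintype A] (p : PMF A) (T : A → Prop) [DecidablePred T]
    (h : ∃ a, T a ∧ p a ≠ 0) :
    HasSum (fun l : List A =>
      (l.map (fun a => if T a then 0 else p a)).prod * ∑ a, if T a then p a else 0) 1 := by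
  set q : ℝ≥0∞ := ∑ a, if T a then 0 else p a with hq
  set r : ℝ≥0∞ := ∑ a, if T a then p a else 0 with hr
  have hqr : q + r = 1 := by
    rw [hq, hr, ← Finset.sum_add_distrib, ← p.tsum_coe, tsum_fintype]
    refine Finset.sum_congr rfl fun a _ => ?_
    by_cases ha : T a <;> simp [ha]
  have hr0 : r ≠ 0 := by
    obtain ⟨a, ha, hpa⟩ := h
    intro h0
    rw [hr, Finset.sum_eq_zero_iff] at h0
    have := h0 a (Finset.mem_univ a)
    simp [ha, hpa] at this
  have hqt : q ≠ ∞ := fun h' => by simp [h'] at hqr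
  have hrt : r ≠ ∞ := fun h' => by simp [h'] at hqr
  have key : ∑' l : List A, (l.map (fun a => if T a then 0 else p a)).prod = ∑' n, q ^ n := by
    rw [← (List.equivSigmaTuple (α := A)).symm.tsum_eq, ENNReal.tsum_sigma']
    refine tsum_congr fun n => ?_
    rw [tsum_fintype, hq, Fintype.sum_pow]
    refine Finset.sum_congr rfl fun f _ => ?_
    simp [List.equivSigmaTuple, List.map_ofFn, List.prod_ofFn]
  have hfin : ∑' l : List A, ((l.map (fun a => if T a then 0 else p a)).prod * r) = 1 := by
    rw [ENNReal.tsum_mul_right, key, ENNReal.tsum_geometric]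
    have : 1 - q = r := by rw [← hqr]; exact ENNReal.add_sub_cancel_left hqt
    rw [this, ENNReal.inv_mul_cancel hr0 hrt]
  rw [← hfin]
  exact ENNReal.summable.hasSum

/-- The law of the word of failures that precede the first success in i.i.d. trials with law `p`,
where `T` is the set of successes: the word `a₁ … a_k` of failures has probability
`p(a₁) ⋯ p(a_k) · p(T)`. -/
def failures {A : Type*} [Fintype A] (p : PMF A) (T : A → Prop) [DecidablePred T]
    (h : ∃ a, T a ∧ p a ≠ 0) : PMF (List A) :=
  ⟨fun l => (l.map (fun a => if T a then 0 else p a)).prod * ∑ a, if T a then p a else 0,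
    hasSum_failures p T h⟩

/-! ### The model -/

/-- The bipartite graph on the disjoint union of customer types and server types. -/
def bipartiteGraph {C S : Type*} (E : Finset (C × S)) : SimpleGraph (C ⊕ S) :=
  SimpleGraph.fromRel fun x y => ∃ c s, (c, s) ∈ E ∧ x = Sum.inl c ∧ y = Sum.inr s

/-- An infinite bipartite matching model `(G, α, β)` with customer types `C`, server types `S`,
connected compatibility graph `G = (C, S, E)`, and strictly positive type probabilities. -/
structure MatchingModel (C S : Type*) where
  E : Finset (C × S)
  connected : (bipartiteGraph E).Connected
  α : PMF C
  β : PMF S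
  α_ne_zero : ∀ c, α c ≠ 0
  β_ne_zero : ∀ s, β s ≠ 0

namespace MatchingModel

variable {C S : Type*}

/-- The model with the roles of customers and servers interchanged. -/
def swap (M : MatchingModel C S) : MatchingModel S C where
  E := M.E.map (Equiv.prodComm C S).toEmbedding
  connected := by
    have e : bipartiteGraph M.E ≃g
        bipartiteGraph (M.E.map (Equiv.prodComm C S).toEmbedding) :=
      { toEquiv := Equiv.sumComm C S
        map_rel_iff' := by
          rintro (a | a) (b | b) <;> simp [bipartiteGraph] }
    exact e.connected_iff.mp M.connected
  α := M.β
  β := M.α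
  α_ne_zero := M.β_ne_zero
  β_ne_zero := M.α_ne_zero

theorem exists_compatible (M : MatchingModel C S) (s : S) :
    ∃ c, (c, s) ∈ M.E ∧ M.α c ≠ 0 := by
  obtain ⟨c₀, -⟩ := M.α.support_nonempty
  have hne : (Sum.inr s : C ⊕ S) ≠ Sum.inl c₀ := by simp
  have : Nontrivial (C ⊕ S) := ⟨⟨_, _, hne⟩⟩
  obtain ⟨x, hx⟩ := M.connected.preconnected.exists_adj_of_nontrivial (Sum.inr s)
  rcases x with c | t
  · exact ⟨c, by simpa [bipartiteGraph] using hx, M.α_ne_zero c⟩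
  · simp [bipartiteGraph] at hx

variable [Fintype C] [DecidableEq C] [Fintype S] [DecidableEq S]

/-- Complete resource pooling: `α_A < β_{S(A)}` for every set `A` of customer types with
`A ≠ ∅` and `A ≠ C`, where `S(A)` is the set of server types compatible with a type in `A`. -/
def CompleteResourcePooling (M : MatchingModel C S) : Prop :=
  ∀ A : Finset C, A.Nonempty → A ≠ Finset.univ →
    ∑ c ∈ A, M.α c < ∑ s ∈ Finset.univ.filter (fun s => ∃ c ∈ A, (c, s) ∈ M.E), M.β s

/-- The types of the fresh customers that a server of type `s` skips before it meets the first
compatible fresh customer. -/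
def skipped (M : MatchingModel C S) (s : S) : PMF (List C) :=
  failures M.α (fun c => (c, s) ∈ M.E) (M.exists_compatible s)

/-! ### The natural chains -/

/-- The chain `Q^s` of server by server matching. The state is the ordered list of skipped
(unmatched) customers. The next server takes the first compatible customer in the list; if there
is none, it goes on to fresh customers, up to the first compatible one. -/
def Qs (M : MatchingModel C S) (q : List C) : PMF (List C) :=
  M.β.bind fun s =>
    if ∃ c ∈ q, (c, s) ∈ M.E then PMF.pure (q.eraseP fun c => (c, s) ∈ M.E)
    else (M.skipped s).map fun l => q ++ l

/-- The chain `Q^c` of customer by customer matching. -/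
def Qc (M : MatchingModel C S) : List S → PMF (List S) := M.swap.Qs

/-- One step of pair by pair matching: the state is the pair of ordered lists of unmatched
customers and unmatched servers, and `(c, s)` is the new pair. -/
def pairStep (M : MatchingModel C S) (c : C) (s : S) (o : List C × List S) : List C × List S :=
  if ∃ x ∈ o.1, (x, s) ∈ M.E then
    if ∃ y ∈ o.2, (c, y) ∈ M.E then
      (o.1.eraseP fun x => (x, s) ∈ M.E, o.2.eraseP fun y => (c, y) ∈ M.E)
    else ((o.1.eraseP fun x => (x, s) ∈ M.E) ++ [c], o.2)
  else
    if ∃ y ∈ o.2, (c, y) ∈ M.E then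
      (o.1, (o.2.eraseP fun y => (c, y) ∈ M.E) ++ [s])
    else if (c, s) ∈ M.E then o
    else (o.1 ++ [c], o.2 ++ [s])

/-- The chain `O` of pair by pair matching. -/
def O (M : MatchingModel C S) (o : List C × List S) : PMF (List C × List S) :=
  M.α.bind fun c => M.β.bind fun s => PMF.pure (M.pairStep c s o)

end MatchingModel

/-! ### Lines with exchanged items

A word in `List (A ⊕ B)` describes consecutive positions on the line of the items of kind `A`
(customers or servers): `Sum.inl a` is a still unmatched item of type `a`, and `Sum.inr b` stands
for an item that has been matched and exchanged with an item of the other kind, of type `b`. -/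

section Lines

variable {A B : Type*}

/-- Match an item of type `b` of the other kind with the first unmatched item on the line whose
type satisfies `p`, and exchange: returns the type of the matched item and the new line, or `none`
if there is no such item. -/
def matchFirst (p : A → Prop) [DecidablePred p] (b : B) :
    List (A ⊕ B) → Option (A × List (A ⊕ B))
  | [] => none
  | Sum.inl a :: w =>
      if p a then some (a, Sum.inr b :: w)
      else (matchFirst p b w).map fun r => (r.1, Sum.inl a :: r.2)
  | Sum.inr b' :: w => (matchFirst p b w).map fun r => (r.1, Sum.inr b' :: r.2)

/-- Delete the exchanged items that precede the first unmatched item. -/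
def trim (w : List (A ⊕ B)) : List (A ⊕ B) := w.dropWhile Sum.isRight

/-- Delete, at the beginning of the line, those exchanged items whose type occurs again
among the later exchanged items. -/
def trimAug [DecidableEq A] [DecidableEq B] : List (A ⊕ B) → List (A ⊕ B)
  | [] => []
  | Sum.inl a :: w => Sum.inl a :: w
  | Sum.inr b :: w => if b ∈ w.filterMap Sum.getRight? then trimAug w else Sum.inr b :: w

end Lines

namespace MatchingModel

variable {C S : Type*} [Fintype C] [DecidableEq C] [Fintype S] [DecidableEq S]

/-- A server of type `s` is matched and exchanged with the first compatible unmatched customer,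
on the customer line that consists of the positions in `w` followed by fresh customers. The new
word ends at the position of the match if this is beyond `w`. -/
def seek (M : MatchingModel C S) (s : S) (w : List (C ⊕ S)) : PMF (List (C ⊕ S)) :=
  match matchFirst (fun c => (c, s) ∈ M.E) s w with
  | some r => PMF.pure r.2
  | none => (M.skipped s).map fun l => w ++ l.map Sum.inl ++ [Sum.inr s]

/-! ### The detailed chains -/

/-- The chain `Z^s` of server by server matching; the state is the part of the customer line
from the first unmatched customer to the last matched and exchanged server. -/
def Zs (M : MatchingModel C S) (z : List (C ⊕ S)) : PMF (List (C ⊕ S)) :=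
  M.β.bind fun s => (M.seek s z).map trim

/-- The chain `Z^c` of customer by customer matching. -/
def Zc (M : MatchingModel C S) : List (S ⊕ C) → PMF (List (S ⊕ C)) := M.swap.Zs

/-- One step of pair by pair backward matching, with new pair `(c, s)`. The state consists of the
part of the customer line from the first unmatched customer up to the current position, and
likewise for the server line. -/
def backwardStep (M : MatchingModel C S) (c : C) (s : S)
    (d : List (C ⊕ S) × List (S ⊕ C)) : List (C ⊕ S) × List (S ⊕ C) :=
  match matchFirst (fun x => (x, s) ∈ M.E) s d.1, matchFirst (fun y => (c, y) ∈ M.E) c d.2 with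
  | some (x, z), some (y, v) => (trim (z ++ [Sum.inr y]), trim (v ++ [Sum.inr x]))
  | some (x, z), none => (trim (z ++ [Sum.inl c]), trim (d.2 ++ [Sum.inr x]))
  | none, some (y, v) => (trim (d.1 ++ [Sum.inr y]), trim (v ++ [Sum.inl s]))
  | none, none =>
      if (c, s) ∈ M.E then (trim (d.1 ++ [Sum.inr s]), trim (d.2 ++ [Sum.inr c]))
      else (trim (d.1 ++ [Sum.inl c]), trim (d.2 ++ [Sum.inl s]))

/-- The chain `D` of pair by pair backward matching. -/
def D (M : MatchingModel C S) (d : List (C ⊕ S) × List (S ⊕ C)) :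
    PMF (List (C ⊕ S) × List (S ⊕ C)) :=
  M.α.bind fun c => M.β.bind fun s => PMF.pure (M.backwardStep c s d)

/-- The first item on a line that consists of the word `w` followed by fresh items of law `p`. -/
def headItem {A B : Type*} (p : PMF A) (w : List (A ⊕ B)) : PMF (A ⊕ B) :=
  match w with
  | [] => p.map Sum.inl
  | x :: _ => PMF.pure x

/-- The chain `E` of pair by pair forward matching. All items up to the current position `N` have
been matched; the state consists of the customer line and of the server line from position `N + 1`
up to the last exchanged item. In one step the items in position `N + 1` that are still unmatched
are matched with each other, or with the first compatible unmatched items in later positions. -/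
def forward (M : MatchingModel C S) (e : List (C ⊕ S) × List (S ⊕ C)) :
    PMF (List (C ⊕ S) × List (S ⊕ C)) :=
  (headItem M.α e.1).bind fun x => (headItem M.β e.2).bind fun y =>
    match x, y with
    | Sum.inl c, Sum.inl s =>
        if (c, s) ∈ M.E then PMF.pure (e.1.tail, e.2.tail)
        else (M.seek s e.1.tail).bind fun z => (M.swap.seek c e.2.tail).map fun v => (z, v)
    | Sum.inl c, Sum.inr _ => (M.swap.seek c e.2.tail).map fun v => (e.1.tail, v)
    | Sum.inr _, Sum.inl s => (M.seek s e.1.tail).map fun z => (z, e.2.tail)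
    | Sum.inr _, Sum.inr _ => PMF.pure (e.1.tail, e.2.tail)

/-! ### The augmented chains -/

/-- The augmented chain `𝒵` of server by server matching. The state is the part of the customer
line that ends with the last exchanged server and begins with the last position such that the
exchanged servers from there on are of all types. -/
def Zaug (M : MatchingModel C S) (z : List (C ⊕ S)) : PMF (List (C ⊕ S)) :=
  M.β.bind fun s => (M.seek s z).map trimAug

/-- The states of `𝒵` in which all customers up to the last exchanged server are matched. -/
def perfectAug (C S : Type*) : Set (List (C ⊕ S)) :=
  {z | ∃ (t : S) (v : List S), z = (t :: v).map Sum.inr ∧ t ∉ v ∧ ∀ s, s ∈ t :: v}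

/-- Extend the line by fresh customers up to the first one of type `c`. -/
def revealUntil (M : MatchingModel C S) (c : C) (w : List (C ⊕ S)) : PMF (List (C ⊕ S)) :=
  (failures M.α (fun a => a = c) ⟨c, rfl, M.α_ne_zero c⟩).map fun l =>
    w ++ l.map Sum.inl ++ [Sum.inl c]

/-- The augmented chain `Z̄^s` of server by server matching. The state is the minimal part of the
customer line that contains an exchanged server of each type and all later exchanged servers, and
the first unmatched customer of each type. So the next server always finds its match in the state,
and fresh customers are revealed if that was the only one of its type. (The case `none` does not
occur in this chain.) -/
def Zbar (M : MatchingModel C S) (z : List (C ⊕ S)) : PMF (List (C ⊕ S)) :=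
  M.β.bind fun s =>
    match matchFirst (fun c => (c, s) ∈ M.E) s z with
    | some (c, w) =>
        (if c ∈ w.filterMap Sum.getLeft? then PMF.pure w else M.revealUntil c w).map trimAug
    | none => PMF.pure z

/-- The states of `Z̄^s` in which all customers up to the last exchanged server are matched. -/
def perfectBar (C S : Type*) : Set (List (C ⊕ S)) :=
  {z | ∃ (t : S) (v : List S) (u : List C) (a : C),
    z = (t :: v).map Sum.inr ++ (u ++ [a]).map Sum.inl ∧
      t ∉ v ∧ (∀ s, s ∈ t :: v) ∧ a ∉ u ∧ ∀ c, c ∈ u ++ [a]}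

end MatchingModel

end

/-!
All nine chains are driven by the same first come first served matching. A natural or detailed chain
is in the empty state after `n` steps exactly when the matching of the first `n` customers with the
first `n` servers is perfect, and an augmented chain is in one of its perfect states exactly then.
Let `perfectProb n` be the probability of this event. By the renewal equation, finiteness of a mean
return time only depends on the sequence of return probabilities: it holds if and only if the
partial sums of this sequence grow linearly (`meanReturnTime_ne_top_iff`). So each chain is ergodic if and only if
`perfectProb` has linear growth, provided that its return probabilities are comparable to
`perfectProb` (`isErgodicChain_iff_of_comparable`; irreducibility follows from recurrence, and
aperiodicity from `perfectProb 0 ≠ 0` and `perfectProb 1 ≠ 0`).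

* For the natural and detailed chains the return probabilities to the empty state are equal to
  `perfectProb`. The underlying fact is that a customer and a server that are compatible, and have
  no compatible partners before each other, are matched to each other and may be removed
  (`serve_remove`). Hence the order in which the matches are made does not matter, and in
  particular `perfectProb` is symmetric in customers and servers.
* For the augmented chains, returns to a state with unmatched customers `u` beyond the exchanged
  servers force a perfect matching (`reachProb_le`). Conversely, a perfect matching can be preceded
  and followed by finitely many prescribed matches that lead from any perfect state to any other
  (`exists_le_reachProb`).

It remains to see that `perfectProb` has linear growth if and only if complete resource pooling
holds (`linearGrowth_iff`).

* If `β(S(A)) ≤ α(A)`, then the positive part of the number of unmatched customers in `A` minus the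
  number of unmatched servers in `S(A)` is a nonnegative submartingale with bounded increments for
  the chain `O`. It leaves `0`, so the empty state cannot have a finite mean return time
  (`meanReturnTime_eq_top_of_submartingale`).
* The chain `Q^s` has the stationary measure
  `(1 - β(S(c₁ … cₙ))) ∏ α(cᵢ) / β(S(c₁ … cᵢ))` (`tsum_stationaryWeight_mul_expect`). Complete
  resource pooling makes it finite, because repetitions of the types in a set `A` contribute a
  geometric series with ratio `α(A) / β(S(A))` (`exists_tsum_le`), and a finite stationary measure
  bounds the mean return time (`meanReturnTime_ne_top_of_subinvariant`).
-/

set_option linter.unusedSectionVars false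

/-! ### Expectations under a discrete law -/

/-- The expectation of `f` under the discrete law `p`. -/
noncomputable def expect {σ : Type*} (p : PMF σ) (f : σ → ℝ≥0∞) : ℝ≥0∞ := ∑' a, p a * f a

section Expect

variable {σ τ : Type*}

theorem expect_pure (a : σ) (f : σ → ℝ≥0∞) : expect (PMF.pure a) f = f a := by
  classical
  rw [expect, tsum_eq_single a]
  · simp
  · intro b hb
    simp [PMF.pure_apply, hb]

theorem expect_bind (p : PMF σ) (q : σ → PMF τ) (f : τ → ℝ≥0∞) :
    expect (p.bind q) f = expect p fun a => expect (q a) f := by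
  simp only [expect, PMF.bind_apply, ← ENNReal.tsum_mul_right, ← ENNReal.tsum_mul_left]
  rw [ENNReal.tsum_comm]
  simp only [mul_assoc]

theorem expect_map (p : PMF σ) (g : σ → τ) (f : τ → ℝ≥0∞) :
    expect (p.map g) f = expect p fun a => f (g a) := by
  rw [← PMF.bind_pure_comp, expect_bind]
  simp [expect_pure]

theorem expect_const (p : PMF σ) (c : ℝ≥0∞) : (expect p fun _ => c) = c := by
  rw [expect, ENNReal.tsum_mul_right, p.tsum_coe, one_mul]

theorem expect_add (p : PMF σ) (f g : σ → ℝ≥0∞) :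
    (expect p fun a => f a + g a) = expect p f + expect p g := by
  simp only [expect, mul_add, ENNReal.tsum_add]

theorem expect_mono (p : PMF σ) {f g : σ → ℝ≥0∞} (h : ∀ a, p a ≠ 0 → f a ≤ g a) :
    expect p f ≤ expect p g := by
  refine ENNReal.tsum_le_tsum fun a => ?_
  by_cases ha : p a = 0
  · simp [ha]
  · exact mul_le_mul_right (h a ha) _

theorem expect_congr (p : PMF σ) {f g : σ → ℝ≥0∞} (h : ∀ a, p a ≠ 0 → f a = g a) :
    expect p f = expect p g :=
  le_antisymm (expect_mono p fun a ha => (h a ha).le) (expect_mono p fun a ha => (h a ha).ge)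

theorem expect_sum {ι : Type*} (s : Finset ι) (p : PMF σ) (f : ι → σ → ℝ≥0∞) :
    (expect p fun a => ∑ i ∈ s, f i a) = ∑ i ∈ s, expect p (f i) := by
  classical
  induction s using Finset.induction_on with
  | empty => simp [expect]
  | insert a s ha ih => simp only [Finset.sum_insert ha, expect_add, ih]

theorem expect_mul_left (p : PMF σ) (c : ℝ≥0∞) (f : σ → ℝ≥0∞) :
    (expect p fun a => c * f a) = c * expect p f := by
  simp only [expect, ← ENNReal.tsum_mul_left, mul_left_comm]

theorem mul_le_expect (p : PMF σ) (f : σ → ℝ≥0∞) (a : σ) : p a * f a ≤ expect p f :=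
  ENNReal.le_tsum a

end Expect

/-! ### Return times and the renewal equation -/

section Renewal

variable {σ τ : Type*} (P : σ → PMF σ)

theorem nStep_succ (n : ℕ) (x y : σ) :
    nStep P (n + 1) x y = expect (P x) fun z => nStep P n z y := rfl

theorem nStep_add (m n : ℕ) (x y : σ) :
    nStep P (m + n) x y = expect (nStep P m x) fun z => nStep P n z y := by
  induction m generalizing x with
  | zero => rw [Nat.zero_add, nStep, expect_pure]
  | succ m ih =>
    rw [Nat.add_right_comm, nStep_succ, nStep, expect_bind]
    exact expect_congr _ fun z _ => ih z

theorem mul_nStep_le (m n : ℕ) (x y z : σ) :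
    nStep P m x y * nStep P n y z ≤ nStep P (m + n) x z := by
  rw [nStep_add]
  exact mul_le_expect _ (fun y => nStep P n y z) y

theorem accessible_of_nStep_ne_zero {n : ℕ} {x y : σ} (h : nStep P n x y ≠ 0) :
    Accessible P x y := by
  classical
  induction n generalizing x with
  | zero =>
    have : y = x := by
      by_contra hne
      exact h (by rw [nStep, PMF.pure_apply, if_neg hne])
    rw [this]
    exact Relation.ReflTransGen.refl
  | succ n ih =>
    rw [nStep_succ] at h
    obtain ⟨z, hz⟩ : ∃ z, P x z * nStep P n z y ≠ 0 := by
      by_contra! hall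
      exact h (by simp [expect, hall])
    exact Relation.ReflTransGen.head (left_ne_zero_of_mul hz) (ih (right_ne_zero_of_mul hz))

theorem exists_nStep_ne_zero {x y : σ} (h : Accessible P x y) : ∃ n, nStep P n x y ≠ 0 := by
  classical
  induction h using Relation.ReflTransGen.head_induction_on with
  | refl => exact ⟨0, by simp [nStep]⟩
  | @head x z hxz _ ih =>
    obtain ⟨n, hn⟩ := ih
    refine ⟨n + 1, fun h0 => ?_⟩
    have := mul_le_expect (P x) (fun z => nStep P n z y) z
    rw [← nStep_succ, h0, nonpos_iff_eq_zero, mul_eq_zero] at this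
    exact this.elim hxz hn

open Classical in
theorem noVisit_succ (x : σ) (n : ℕ) (y : σ) :
    noVisit P x (n + 1) y = expect (P y) fun z => if z = x then 0 else noVisit P x n z := rfl

/-- Decomposition of the certain event according to the last visit of `x` up to time `n`. -/
theorem noVisit_add_sum (x : σ) (n : ℕ) (y : σ) :
    noVisit P x n y +
      ∑ k ∈ Finset.range n, nStep P (k + 1) y x * noVisit P x (n - 1 - k) x = 1 := by
  classical
  induction n generalizing y with
  | zero => simp [noVisit]
  | succ n ih =>
    have h0 : nStep P 1 y x = expect (P y) fun z => if z = x then 1 else 0 := by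
      rw [nStep_succ]
      exact expect_congr _ fun z _ => by simp [nStep, PMF.pure_apply, eq_comm]
    rw [Finset.sum_range_succ', noVisit_succ]
    have h1 : ∀ k ∈ Finset.range n, nStep P (k + 1 + 1) y x * noVisit P x (n + 1 - 1 - (k + 1)) x
        = expect (P y) fun z => nStep P (k + 1) z x * noVisit P x (n - 1 - k) x := by
      intro k _
      rw [nStep_succ, show n + 1 - 1 - (k + 1) = n - 1 - k by omega, mul_comm,
        ← expect_mul_left]
      exact expect_congr _ fun z _ => mul_comm _ _
    rw [Finset.sum_congr rfl h1, ← expect_sum, zero_add, h0, mul_comm, ← expect_mul_left,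
      ← expect_add, ← expect_add]
    refine Eq.trans (expect_congr _ fun z _ => ?_) (expect_const (P y) 1)
    refine Eq.trans ?_ (ih z)
    by_cases hz : z = x
    · simp [hz, add_comm]
    · simp [hz]

theorem sum_nStep_mul_noVisit (x : σ) (n : ℕ) :
    ∑ k ∈ Finset.range (n + 1), nStep P k x x * noVisit P x (n - k) x = 1 := by
  classical
  rw [Finset.sum_range_succ', ← noVisit_add_sum P x n x, add_comm]
  congr 1
  · simp [nStep]
  · exact Finset.sum_congr rfl fun k _ => by rw [Nat.sub_add_eq, Nat.sub_right_comm]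

/-- The partial sums of `u` grow at least linearly. -/
def LinearGrowth (u : ℕ → ℝ≥0∞) : Prop :=
  ∃ ε : ℝ≥0∞, ε ≠ 0 ∧ ∃ N₀ : ℕ, ∀ N ≥ N₀, ε * N ≤ ∑ n ∈ Finset.range N, u n

theorem LinearGrowth.of_shift_le {u v : ℕ → ℝ≥0∞} (hu : LinearGrowth u) {δ : ℝ≥0∞} (hδ : δ ≠ 0)
    (m : ℕ) (h : ∀ n, δ * u n ≤ v (m + n)) : LinearGrowth v := by
  obtain ⟨ε, hε, N₀, hN⟩ := hu
  refine ⟨δ * ε / 2, by simp [ENNReal.div_eq_zero_iff, hδ, hε], N₀ + 2 * m, fun N hNN => ?_⟩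
  obtain ⟨K, rfl⟩ : ∃ K, N = m + K := ⟨N - m, by omega⟩
  have hK : (m + K : ℕ) ≤ 2 * (K : ℝ≥0∞) := by
    rw [← Nat.cast_ofNat, ← Nat.cast_mul]
    exact_mod_cast (by omega : m + K ≤ 2 * K)
  calc δ * ε / 2 * (m + K : ℕ) ≤ δ * ε / 2 * (2 * (K : ℝ≥0∞)) := by gcongr
    _ = δ * (ε * K) := by
      rw [← mul_assoc, ENNReal.div_mul_cancel (by simp) (by simp), mul_assoc]
    _ ≤ δ * ∑ n ∈ Finset.range K, u n := by gcongr; exact hN K (by omega)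
    _ = ∑ n ∈ Finset.range K, δ * u n := Finset.mul_sum ..
    _ ≤ ∑ n ∈ Finset.range K, v (m + n) := Finset.sum_le_sum fun n _ => h n
    _ ≤ ∑ n ∈ Finset.range (m + K), v n := by
      rw [Finset.sum_range_add]
      exact le_add_self

theorem LinearGrowth.of_le {u v : ℕ → ℝ≥0∞} (hu : LinearGrowth u) (h : ∀ n, u n ≤ v n) :
    LinearGrowth v :=
  hu.of_shift_le one_ne_zero 0 fun n => by simpa using h n

theorem sum_range_eq_sum_mul_sum (x : σ) (N : ℕ) :
    ∑ k ∈ Finset.range N, nStep P k x x * ∑ j ∈ Finset.range (N - k), noVisit P x j x = N := by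
  induction N with
  | zero => simp
  | succ N ih =>
    have h : ∀ k ∈ Finset.range (N + 1),
        nStep P k x x * ∑ j ∈ Finset.range (N + 1 - k), noVisit P x j x =
          nStep P k x x * ∑ j ∈ Finset.range (N - k), noVisit P x j x +
            nStep P k x x * noVisit P x (N - k) x := by
      intro k hk
      rw [Finset.mem_range] at hk
      rw [show N + 1 - k = (N - k) + 1 by omega, Finset.sum_range_succ, mul_add]
    rw [Finset.sum_congr rfl h, Finset.sum_add_distrib, sum_nStep_mul_noVisit,
      Finset.sum_range_succ, ih]
    simp

/-- By the renewal equation, the mean return time is finite if and only if the expected number of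
visits up to time `N` is at least of order `N`. So positive recurrence of `x` only depends on the
sequence of return probabilities. -/
theorem meanReturnTime_ne_top_iff (x : σ) :
    meanReturnTime P x ≠ ∞ ↔ LinearGrowth fun n => nStep P n x x := by
  constructor
  · intro h
    refine ⟨(meanReturnTime P x)⁻¹, ENNReal.inv_ne_zero.2 h, 0, fun N _ => ?_⟩
    rw [mul_comm, ← div_eq_mul_inv]
    refine ENNReal.div_le_of_le_mul ?_
    rw [← sum_range_eq_sum_mul_sum P x N, Finset.sum_mul]
    refine Finset.sum_le_sum fun k _ => ?_
    gcongr
    exact ENNReal.sum_le_tsum _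
  · rintro ⟨ε, hε, N₀, hN⟩
    have hε' : ε ≠ ∞ := by
      rintro rfl
      have h := hN (N₀ + 1) (by omega)
      rw [ENNReal.top_mul (by simp)] at h
      have : ∑ n ∈ Finset.range (N₀ + 1), nStep P n x x ≤ ∑ n ∈ Finset.range (N₀ + 1), 1 :=
        Finset.sum_le_sum fun n _ => PMF.coe_le_one _ _
      simp only [Finset.sum_const, Finset.card_range, nsmul_eq_mul, mul_one] at this
      exact ENNReal.natCast_ne_top _ (top_le_iff.1 (h.trans this))
    -- up to time `2 * K`, each visit before time `K` leaves at least `K` terms of the tail sum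
    have hbound : meanReturnTime P x ≤ 2 / ε := by
      rw [meanReturnTime, ENNReal.tsum_eq_iSup_nat]
      refine iSup_le fun N => ?_
      refine le_trans (Finset.sum_le_sum_of_subset (Finset.range_mono
        (show N ≤ N + N₀ + 1 by omega))) ?_
      set K := N + N₀ + 1 with hK
      have h2 := sum_range_eq_sum_mul_sum P x (K + K)
      have h3 : ε * K * ∑ j ∈ Finset.range K, noVisit P x j x ≤ (K + K : ℕ) := by
        rw [← h2]
        calc ε * K * ∑ j ∈ Finset.range K, noVisit P x j x
            ≤ (∑ k ∈ Finset.range K, nStep P k x x) * ∑ j ∈ Finset.range K, noVisit P x j x := by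
              gcongr
              exact hN K (by omega)
          _ = ∑ k ∈ Finset.range K, nStep P k x x * ∑ j ∈ Finset.range K, noVisit P x j x :=
              Finset.sum_mul ..
          _ ≤ ∑ k ∈ Finset.range K,
                nStep P k x x * ∑ j ∈ Finset.range (K + K - k), noVisit P x j x := by
              refine Finset.sum_le_sum fun k hk => ?_
              rw [Finset.mem_range] at hk
              gcongr
              omega
          _ ≤ _ := Finset.sum_le_sum_of_subset (Finset.range_mono (by omega))
      have hK0 : (K : ℝ≥0∞) ≠ 0 := by simp [hK]
      clear_value K
      rw [ENNReal.le_div_iff_mul_le (Or.inl hε) (Or.inl hε')]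
      rw [Nat.cast_add, ← two_mul, mul_assoc, mul_left_comm, mul_comm (2 : ℝ≥0∞),
        ENNReal.mul_le_mul_iff_right hK0 (ENNReal.natCast_ne_top _)] at h3
      rwa [mul_comm]
    exact ne_top_of_le_ne_top (ENNReal.div_ne_top (by simp) hε) hbound

/-! ### Criteria for ergodicity -/

theorem noVisit_eq_one_of_not_accessible {x y : σ} (h : ¬ Accessible P y x) (n : ℕ) :
    noVisit P x n y = 1 := by
  classical
  induction n generalizing y with
  | zero => rfl
  | succ n ih =>
    rw [noVisit_succ, ← expect_const (P y) 1]
    refine expect_congr _ fun z hz => ?_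
    rw [if_neg, ih fun hzx => h (Relation.ReflTransGen.head hz hzx)]
    rintro rfl
    exact h (Relation.ReflTransGen.single hz)

/-- A state with finite mean return time is accessible from all states that are accessible
from it. -/
theorem accessible_symm_of_meanReturnTime_ne_top {x y : σ} (h : meanReturnTime P x ≠ ∞)
    (hxy : Accessible P x y) : Accessible P y x := by
  classical
  by_contra hyx
  -- a path to `y` either gives a uniform lower bound for `noVisit` at its start, or it returns
  -- to `x` and its last part, which starts at `x`, gives one
  have key : ∀ z, Accessible P z y → (∃ c ≠ 0, ∀ n, c ≤ noVisit P x n z) ∨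
      ∃ c ≠ 0, ∀ n, c ≤ noVisit P x n x := by
    intro z hz
    induction hz using Relation.ReflTransGen.head_induction_on with
    | refl =>
      exact Or.inl ⟨1, one_ne_zero, fun n => (noVisit_eq_one_of_not_accessible P hyx n).ge⟩
    | @head z w hzw _ ih =>
      rcases ih with ⟨c, hc, hcn⟩ | hx
      · by_cases hw : w = x
        · subst hw
          exact Or.inr ⟨c, hc, hcn⟩
        · refine Or.inl ⟨P z w * c, mul_ne_zero hzw hc, fun n => ?_⟩
          cases n with
          | zero => exact mul_le_one' (PMF.coe_le_one _ _) (hcn 0)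
          | succ n =>
            rw [noVisit_succ]
            refine le_trans ?_ (mul_le_expect _ _ w)
            rw [if_neg hw]
            gcongr
            exact hcn n
      · exact Or.inr hx
  obtain ⟨c, hc, hcn⟩ : ∃ c ≠ 0, ∀ n, c ≤ noVisit P x n x := (key x hxy).elim id id
  refine h (top_le_iff.1 ?_)
  rw [← ENNReal.tsum_const_eq_top_of_ne_zero (α := ℕ) hc]
  exact ENNReal.tsum_le_tsum hcn

/-- If the return probabilities of the states in `init` are comparable to a fixed sequence `u`,
up to shifts, then the chain is ergodic if and only if `u` has linear growth. -/
theorem isErgodicChain_iff_of_comparable {init : Set σ} (u : ℕ → ℝ≥0∞)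
    (hu0 : u 0 ≠ 0) (hu1 : u 1 ≠ 0) (hne : init.Nonempty)
    (hupper : ∀ x ∈ init, ∀ n, nStep P n x x ≤ u n)
    (hlower : ∀ x ∈ init, ∀ y ∈ init, ∃ δ ≠ 0, ∃ m, ∀ n, δ * u n ≤ nStep P (m + n) x y) :
    IsErgodicChain P init ↔ LinearGrowth u := by
  obtain ⟨x₀, hx₀⟩ := hne
  constructor
  · intro h
    have := h.positiveRecurrent x₀ ⟨x₀, hx₀, Relation.ReflTransGen.refl⟩
    rw [meanReturnTime_ne_top_iff] at this
    exact this.of_le (hupper x₀ hx₀)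
  · intro h
    obtain ⟨δ, hδ, m, hm⟩ := hlower x₀ hx₀ x₀ hx₀
    -- with finite mean return time to `x₀`, all states communicate with `x₀`, and the lower bound
    -- for the return probabilities of `x₀` carries over to them
    have hpos : meanReturnTime P x₀ ≠ ∞ := by
      rw [meanReturnTime_ne_top_iff]
      exact h.of_shift_le hδ m hm
    have hfrom : ∀ y ∈ stateSpace P init, Accessible P x₀ y := by
      rintro y ⟨x, hx, hxy⟩
      obtain ⟨δ', hδ', m', hm'⟩ := hlower x₀ hx₀ x hx
      refine Relation.ReflTransGen.trans (accessible_of_nStep_ne_zero P (n := m' + 0) ?_) hxy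
      exact ne_bot_of_le_ne_bot (mul_ne_zero hδ' hu0) (hm' 0)
    have hto : ∀ y ∈ stateSpace P init, Accessible P y x₀ := fun y hy =>
      accessible_symm_of_meanReturnTime_ne_top P hpos (hfrom y hy)
    have hloop : ∀ y ∈ stateSpace P init, ∃ δ' ≠ 0, ∃ m', ∀ n, δ' * u n ≤ nStep P (m' + n) y y := by
      intro y hy
      obtain ⟨a, ha⟩ := exists_nStep_ne_zero P (hto y hy)
      obtain ⟨b, hb⟩ := exists_nStep_ne_zero P (hfrom y hy)
      refine ⟨nStep P a y x₀ * δ * nStep P b x₀ y, mul_ne_zero (mul_ne_zero ha hδ) hb,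
        a + m + b, fun n => ?_⟩
      calc nStep P a y x₀ * δ * nStep P b x₀ y * u n
          = nStep P a y x₀ * (δ * u n) * nStep P b x₀ y := by ring
        _ ≤ nStep P a y x₀ * nStep P (m + n) x₀ x₀ * nStep P b x₀ y := by
          gcongr
          exact hm n
        _ ≤ nStep P (a + (m + n)) y x₀ * nStep P b x₀ y := by
          gcongr
          exact mul_nStep_le P ..
        _ ≤ nStep P (a + (m + n) + b) y y := mul_nStep_le P ..
        _ = nStep P (a + m + b + n) y y := by
          rw [show a + (m + n) + b = a + m + b + n by omega]
    refine ⟨fun x hx y hy => (hto x hx).trans (hfrom y hy), fun x hx d hd => ?_, fun x hx => ?_⟩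
    · obtain ⟨δ', hδ', m', hm'⟩ := hloop x hx
      have h0 := hd (m' + 0) (ne_bot_of_le_ne_bot (mul_ne_zero hδ' hu0) (hm' 0))
      have h1 := hd (m' + 1) (ne_bot_of_le_ne_bot (mul_ne_zero hδ' hu1) (hm' 1))
      exact Nat.dvd_one.1 ((Nat.dvd_add_right h0).1 h1)
    · obtain ⟨δ', hδ', m', hm'⟩ := hloop x hx
      rw [meanReturnTime_ne_top_iff]
      exact h.of_shift_le hδ' m' hm'

theorem isErgodicChain_singleton_iff {x : σ} (u : ℕ → ℝ≥0∞) (hu1 : u 1 ≠ 0)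
    (h : ∀ n, nStep P n x x = u n) : IsErgodicChain P {x} ↔ LinearGrowth u := by
  refine isErgodicChain_iff_of_comparable P u ?_ hu1 ⟨x, rfl⟩ ?_ ?_
  · rw [← h 0]
    simp [nStep]
  · rintro y rfl n
    exact (h n).le
  · rintro y rfl z rfl
    exact ⟨1, one_ne_zero, 0, fun n => by rw [one_mul, zero_add, h n]⟩

/-- The transition probabilities of a chain and of its image under a lumping map agree, for a
target state that is the only one in its fibre. -/
theorem nStep_eq_of_lump (Q : τ → PMF τ) (φ : σ → τ) (I : Set σ)
    (hI : ∀ x ∈ I, ∀ y, P x y ≠ 0 → y ∈ I) (hPQ : ∀ x ∈ I, (P x).map φ = Q (φ x)) {x₀ : σ}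
    (hx₀ : ∀ x ∈ I, φ x = φ x₀ → x = x₀) (n : ℕ) {x : σ} (hx : x ∈ I) :
    nStep Q n (φ x) (φ x₀) = nStep P n x x₀ := by
  classical
  induction n generalizing x with
  | zero =>
    have : (φ x₀ = φ x) ↔ (x₀ = x) :=
      ⟨fun h => (hx₀ x hx h.symm).symm, fun h => congrArg φ h⟩
    simp [nStep, PMF.pure_apply, this]
  | succ n ih =>
    rw [nStep_succ, nStep_succ, ← hPQ x hx, expect_map]
    exact expect_congr _ fun y hy => ih (hI x hx y hy)

/-- A state charged by a finite subinvariant measure `π` has a finite mean return time: the mass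
`∑ π(y) P_y(T_x > n)` decreases by at least `π(x) P_x(T_x > n)` in step `n`. -/
theorem meanReturnTime_ne_top_of_subinvariant (π : σ → ℝ≥0∞) (hπ : ∑' y, π y ≠ ∞)
    (hsub : ∀ f : σ → ℝ≥0∞, ∑' y, π y * expect (P y) f ≤ ∑' y, π y * f y) {x : σ}
    (hx : π x ≠ 0) : meanReturnTime P x ≠ ∞ := by
  classical
  have hxt : π x ≠ ∞ := ne_top_of_le_ne_top hπ (ENNReal.le_tsum x)
  have key : ∀ N, (∑' y, π y * noVisit P x N y) +
      π x * ∑ n ∈ Finset.range N, noVisit P x n x ≤ ∑' y, π y := by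
    intro N
    induction N with
    | zero => simp [noVisit]
    | succ N ih =>
      refine le_trans ?_ ih
      rw [Finset.sum_range_succ, mul_add, add_comm (π x * _), ← add_assoc]
      gcongr
      have h1 : ∑' y, π y * noVisit P x (N + 1) y ≤
          ∑' y, π y * (if y = x then 0 else noVisit P x N y) := by
        simp only [noVisit_succ]
        exact hsub fun z => if z = x then 0 else noVisit P x N z
      refine (add_le_add_left h1 _).trans ?_
      have h2 : π x * noVisit P x N x = ∑' y, if y = x then π x * noVisit P x N x else 0 := by
        rw [tsum_ite_eq]
      rw [h2, ← ENNReal.tsum_add]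
      refine ENNReal.tsum_le_tsum fun y => ?_
      by_cases hy : y = x <;> simp [hy]
  have : meanReturnTime P x ≤ (∑' y, π y) / π x := by
    rw [meanReturnTime, ENNReal.tsum_eq_iSup_nat]
    refine iSup_le fun N => ?_
    rw [ENNReal.le_div_iff_mul_le (Or.inl hx) (Or.inl hxt), mul_comm]
    exact le_add_self.trans (key N)
  exact ne_top_of_le_ne_top (ENNReal.div_ne_top hπ hx) this

/-- A nonnegative submartingale `f` with bounded increments that vanishes at `x` and does not stay
there prevents a finite mean return time to `x`: the expectation of `f` on `T_x > n` stays above a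
constant, and it is at most of order `n P_x(T_x > n)`, so the tail of `T_x` is at least harmonic. -/
theorem meanReturnTime_eq_top_of_submartingale {x : σ} (f : σ → ℝ≥0∞) (hfx : f x = 0) (K : ℕ)
    (hK : ∀ y z, P y z ≠ 0 → f z ≤ f y + K) (hf : ∀ y, f y ≤ expect (P y) f)
    (hx : expect (P x) f ≠ 0) : meanReturnTime P x = ∞ := by
  classical
  let A : ℕ → σ → ℝ≥0∞ := fun n => Nat.rec f
    (fun _ g y => expect (P y) fun z => if z = x then 0 else g z) n
  have hA : ∀ n y, A (n + 1) y = expect (P y) fun z => if z = x then 0 else A n z :=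
    fun n y => rfl
  have hstep : ∀ g : σ → ℝ≥0∞, (∀ y, f y ≤ g y) → ∀ y,
      expect (P y) f ≤ expect (P y) fun z => if z = x then 0 else g z := by
    intro g hg y
    refine expect_mono _ fun z _ => ?_
    by_cases hz : z = x
    · simp [hz, hfx]
    · simpa [hz] using hg z
  have hlow : ∀ n y, f y ≤ A n y := by
    intro n
    induction n with
    | zero => exact fun y => le_rfl
    | succ n ih => exact fun y => (hf y).trans (hstep _ ih y)
  have hupp : ∀ n y, A n y ≤ (f y + K * n) * noVisit P x n y := by
    intro n
    induction n with
    | zero => intro y; simp [A, noVisit]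
    | succ n ih =>
      intro y
      rw [hA, noVisit_succ, ← expect_mul_left]
      refine expect_mono _ fun z hz => ?_
      by_cases hzx : z = x
      · simp [hzx]
      · simp only [hzx, if_false]
        refine (ih z).trans ?_
        refine mul_le_mul_left ((add_le_add_left (hK y z hz) _).trans (le_of_eq ?_)) _
        push_cast
        ring
  have hmain : ∀ n : ℕ, expect (P x) f ≤ K * (n + 1) * noVisit P x (n + 1) x := by
    intro n
    have h1 := (hstep (A n) (hlow n) x).trans (hupp (n + 1) x)
    rw [hfx, zero_add] at h1
    exact_mod_cast h1
  by_contra htop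
  have hfin : expect (P x) f ≤ K := by
    refine (expect_mono (P x) fun z hz => hK x z hz).trans ?_
    rw [expect_const, hfx, zero_add]
  have hδt : expect (P x) f ≠ ∞ := ne_top_of_le_ne_top (ENNReal.natCast_ne_top _) hfin
  have hK0 : (K : ℝ≥0∞) ≠ 0 := fun h0 => hx (by simpa [h0] using hfin)
  have hdiv : ∑' n : ℕ, ((n : ℝ≥0∞) + 1)⁻¹ = ∞ := by
    by_contra hne
    have hs : Summable fun n : ℕ => (1 : ℝ) / ((n : ℝ) + 1) := by
      refine (ENNReal.summable_toReal hne).congr fun n => ?_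
      rw [ENNReal.toReal_inv, one_div]
      norm_cast
    have := (summable_nat_add_iff (f := fun n : ℕ => (1 : ℝ) / n) 1).1
      (by simpa using hs)
    exact Real.not_summable_one_div_natCast this
  have hle : (∑' n : ℕ, expect (P x) f / K * ((n : ℝ≥0∞) + 1)⁻¹) ≤ meanReturnTime P x := by
    rw [show meanReturnTime P x = _ from tsum_eq_zero_add' ENNReal.summable]
    refine le_trans (ENNReal.tsum_le_tsum fun n => ?_) le_add_self
    rw [← div_eq_mul_inv]
    refine ENNReal.div_le_of_le_mul (ENNReal.div_le_of_le_mul ?_)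
    exact (hmain n).trans (le_of_eq (by ring))
  rw [ENNReal.tsum_mul_left, hdiv, ENNReal.mul_top] at hle
  · exact htop (top_le_iff.1 hle)
  · exact (ENNReal.div_pos hx (ENNReal.natCast_ne_top _)).ne'

end Renewal

/-! ### Sums over words -/

section Words

variable {A B : Type*}

theorem tsum_list_eq (F : List A → ℝ≥0∞) :
    ∑' l, F l = F [] + ∑' a, ∑' l, F (a :: l) := by
  let e : Unit ⊕ (A × List A) ≃ List A :=
    { toFun := Sum.elim (fun _ => []) fun x => x.1 :: x.2
      invFun := fun l => match l with
        | [] => Sum.inl ()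
        | a :: l => Sum.inr (a, l)
      left_inv := by rintro (_ | ⟨a, l⟩) <;> rfl
      right_inv := by rintro (_ | ⟨a, l⟩) <;> rfl }
  rw [← e.tsum_eq F, Summable.tsum_sum (f := fun x => F (e x)) ENNReal.summable ENNReal.summable,
    tsum_fintype, ← ENNReal.tsum_prod]
  simp [e]

open Classical in
/-- A sum over the words that contain a letter in `T`, split at the first such letter. -/
theorem tsum_list_split (T : A → Prop) (H : List A → ℝ≥0∞)
    (hH : ∀ l, (∀ a ∈ l, ¬ T a) → H l = 0) :
    ∑' l, H l = ∑' l₀, ∑' a, ∑' l₁,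
      if (∀ x ∈ l₀, ¬ T x) ∧ T a then H (l₀ ++ a :: l₁) else 0 := by
  let D : Set (List A × A × List A) := {x | (∀ y ∈ x.1, ¬ T y) ∧ T x.2.1}
  let i : D → List A := fun x => x.1.1 ++ x.1.2.1 :: x.1.2.2
  have hi : Function.Injective i := by
    rintro ⟨⟨l, a, m⟩, h1, h2⟩ ⟨⟨l', a', m'⟩, h1', h2'⟩ h
    have ht := congrArg (List.takeWhile fun x => decide (¬ T x)) h
    have hd := congrArg (List.dropWhile fun x => decide (¬ T x)) h
    simp only [i] at ht hd
    dsimp only at h1 h2 h1' h2'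
    rw [List.takeWhile_append_of_pos (by simpa using h1),
      List.takeWhile_append_of_pos (by simpa using h1')] at ht
    rw [List.dropWhile_append_of_pos (by simpa using h1),
      List.dropWhile_append_of_pos (by simpa using h1')] at hd
    simp only [List.takeWhile_cons, List.dropWhile_cons, h2, h2', not_true, decide_false,
      Bool.false_eq_true, if_false, List.append_nil, List.cons.injEq] at ht hd
    simp [ht, hd]
  have hrange : Function.support H ⊆ Set.range i := by
    intro l hl
    have : ∃ a ∈ l, T a := by
      by_contra! h
      exact hl (hH l h)
    obtain ⟨a, ha, hTa⟩ := this
    obtain ⟨b, l₁, l₂, h1, h2, h3, -⟩ :=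
      List.exists_of_eraseP (p := fun a => decide (T a)) ha (by simpa using hTa)
    exact ⟨⟨(l₁, b, l₂), by simpa using h1, by simpa using h2⟩, h3.symm⟩
  rw [← hi.tsum_eq hrange, tsum_subtype D fun x => H (x.1 ++ x.2.1 :: x.2.2),
    ENNReal.tsum_prod (f := fun a b => D.indicator (fun x => H (x.1 ++ x.2.1 :: x.2.2)) (a, b))]
  refine tsum_congr fun l => ?_
  rw [ENNReal.tsum_prod
    (f := fun a b => D.indicator (fun x => H (x.1 ++ x.2.1 :: x.2.2)) (l, a, b))]
  refine tsum_congr fun a => tsum_congr fun m => ?_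
  simp [Set.indicator_apply, D]

/-- The weight of a word: the probability that i.i.d. letters of law `p` begin with this word. -/
noncomputable def wordWeight (p : PMF A) (l : List A) : ℝ≥0∞ := (l.map p).prod

@[simp] theorem wordWeight_nil (p : PMF A) : wordWeight p [] = 1 := by simp [wordWeight]

@[simp] theorem wordWeight_cons (p : PMF A) (a : A) (l : List A) :
    wordWeight p (a :: l) = p a * wordWeight p l := by simp [wordWeight]

@[simp] theorem wordWeight_append (p : PMF A) (l m : List A) :
    wordWeight p (l ++ m) = wordWeight p l * wordWeight p m := by simp [wordWeight]

theorem wordWeight_ne_zero {p : PMF A} (hp : ∀ a, p a ≠ 0) (l : List A) :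
    wordWeight p l ≠ 0 := by
  induction l with
  | nil => simp
  | cons a l ih => simp [hp a, ih]

theorem wordWeight_ne_top (p : PMF A) (l : List A) : wordWeight p l ≠ ∞ := by
  induction l with
  | nil => simp
  | cons a l ih => rw [wordWeight_cons]; exact ENNReal.mul_ne_top (p.apply_ne_top a) ih

/-- The weighted sum of `F` over all finite words. -/
noncomputable def wordSum (p : PMF A) (F : List A → ℝ≥0∞) : ℝ≥0∞ := ∑' l, wordWeight p l * F l

theorem wordSum_eq (p : PMF A) (F : List A → ℝ≥0∞) :
    wordSum p F = F [] + expect p fun a => wordSum p fun l => F (a :: l) := by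
  simp only [wordSum, expect]
  rw [tsum_list_eq]
  simp only [wordWeight_nil, one_mul, wordWeight_cons, mul_assoc, ENNReal.tsum_mul_left]

theorem wordSum_zero (p : PMF A) : (wordSum p fun _ => 0) = 0 := by simp [wordSum]

theorem wordSum_congr (p : PMF A) {F G : List A → ℝ≥0∞} (h : ∀ l, F l = G l) :
    wordSum p F = wordSum p G := by simp only [wordSum, h]

theorem wordSum_mul_left (p : PMF A) (c : ℝ≥0∞) (F : List A → ℝ≥0∞) :
    (wordSum p fun l => c * F l) = c * wordSum p F := by
  simp only [wordSum, ← ENNReal.tsum_mul_left, mul_left_comm]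

theorem wordSum_eq_nil (p : PMF A) {F : List A → ℝ≥0∞} (h : ∀ l, l ≠ [] → F l = 0) :
    wordSum p F = F [] := by
  rw [wordSum_eq]
  simp [h, wordSum_zero, expect_const]

theorem wordSum_comm (p : PMF A) (q : PMF B) (F : List A → List B → ℝ≥0∞) :
    (wordSum p fun l => wordSum q fun m => F l m) =
      wordSum q fun m => wordSum p fun l => F l m := by
  simp only [wordSum, ← ENNReal.tsum_mul_left]
  rw [ENNReal.tsum_comm]
  simp only [mul_left_comm]

theorem expect_wordSum {σ : Type*} (p : PMF A) (q : PMF σ) (F : σ → List A → ℝ≥0∞) :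
    (expect q fun z => wordSum p (F z)) = wordSum p fun l => expect q fun z => F z l := by
  simp only [wordSum, expect, ← ENNReal.tsum_mul_left]
  rw [ENNReal.tsum_comm]
  simp only [mul_left_comm]

theorem le_wordSum (p : PMF A) (F : List A → ℝ≥0∞) (a b : List A) :
    wordWeight p a * wordWeight p b * wordSum p (fun l => F (a ++ (l ++ b))) ≤ wordSum p F := by
  rw [← wordSum_mul_left]
  refine le_trans (le_of_eq ?_) (ENNReal.tsum_comp_le_tsum_of_injective
    (f := fun l => a ++ (l ++ b)) (fun l m h => ?_) _)
  · refine tsum_congr fun l => ?_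
    rw [wordWeight_append, wordWeight_append]
    ring
  · exact List.append_cancel_right (List.append_cancel_left h)

theorem exists_cons_cover [Finite A] [Nonempty A] :
    ∃ (t : A) (v : List A), t ∉ v ∧ ∀ s, s ∈ t :: v := by
  classical
  cases nonempty_fintype A
  have h1 := Finset.nodup_toList (Finset.univ : Finset A)
  have h2 : ∀ s, s ∈ (Finset.univ : Finset A).toList := by simp
  cases h : (Finset.univ : Finset A).toList with
  | nil => simp [h] at h2
  | cons t v =>
    rw [h] at h1 h2
    exact ⟨t, v, (List.nodup_cons.1 h1).1, h2⟩

theorem failures_apply [Fintype A] (p : PMF A) (T : A → Prop) [DecidablePred T]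
    (h : ∃ a, T a ∧ p a ≠ 0) (l : List A) :
    failures p T h l =
      (l.map (fun a => if T a then 0 else p a)).prod * ∑ a, if T a then p a else 0 := rfl

open Classical in
theorem prod_map_failure (p : PMF A) (T : A → Prop) [DecidablePred T] (l : List A) :
    (l.map (fun a => if T a then 0 else p a)).prod =
      if ∀ x ∈ l, ¬ T x then wordWeight p l else 0 := by
  induction l with
  | nil => simp
  | cons a l ih =>
    rw [List.map_cons, List.prod_cons, ih]
    by_cases ha : T a <;> by_cases hl : ∀ x ∈ l, ¬ T x <;> simp [ha, hl]

/-- The words behind the first success are again i.i.d. -/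
theorem expect_failures_wordSum [Fintype A] (p : PMF A) (T : A → Prop) [DecidablePred T]
    (h : ∃ a, T a ∧ p a ≠ 0) (G : List A → List A → ℝ≥0∞) (H : List A → ℝ≥0∞)
    (hH : ∀ l, (∀ a ∈ l, ¬ T a) → H l = 0)
    (hG : ∀ l a m, (∀ x ∈ l, ¬ T x) → T a → H (l ++ a :: m) = G l m) :
    (expect (failures p T h) fun l => wordSum p (G l)) = wordSum p H := by
  classical
  rw [wordSum, tsum_list_split T _ fun l hl => by rw [hH l hl, mul_zero], expect]
  refine tsum_congr fun l => ?_
  rw [failures_apply, prod_map_failure, ← tsum_fintype (L := .unconditional _)]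
  by_cases hl : ∀ x ∈ l, ¬ T x
  · rw [if_pos hl, mul_assoc, ← ENNReal.tsum_mul_right, ← ENNReal.tsum_mul_left]
    refine tsum_congr fun a => ?_
    by_cases ha : T a
    · rw [if_pos ha, wordSum, ← ENNReal.tsum_mul_left, ← ENNReal.tsum_mul_left]
      refine tsum_congr fun m => ?_
      rw [if_pos ⟨hl, ha⟩, hG l a m hl ha, wordWeight_append, wordWeight_cons]
      ring
    · simp [ha]
  · simp [hl]

end Words

/-! ### First come first served matching of finite lists -/

section Serve

variable {C S : Type*} [DecidableEq C] [DecidableEq S]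

/-- The customers in the list `q` that remain when the servers of the given types, one after the
other, take the first compatible customer; `none` if some server does not find one. -/
def serve (E : Finset (C × S)) : List S → List C → Option (List C)
  | [], q => some q
  | s :: ss, q =>
      if ∃ c ∈ q, (c, s) ∈ E then serve E ss (q.eraseP fun c => (c, s) ∈ E) else none

variable (E : Finset (C × S))

theorem eraseP_append_cons {A : Type*} (T : A → Prop) [DecidablePred T] {l m : List A} {a : A}
    (hl : ∀ x ∈ l, ¬ T x) (ha : T a) : (l ++ a :: m).eraseP (fun x => T x) = l ++ m := by
  rw [List.eraseP_append_right _ (by simpa using hl), List.eraseP_cons_of_pos (by simpa using ha)]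

theorem exists_first {A : Type*} (T : A → Prop) {l : List A} (h : ∃ a ∈ l, T a) :
    ∃ l₁ a l₂, l = l₁ ++ a :: l₂ ∧ T a ∧ ∀ x ∈ l₁, ¬ T x := by
  classical
  obtain ⟨a, ha, hTa⟩ := h
  obtain ⟨b, l₁, l₂, h1, h2, h3, -⟩ :=
    List.exists_of_eraseP (p := fun a => decide (T a)) ha (by simpa using hTa)
  exact ⟨l₁, b, l₂, h3, by simpa using h2, by simpa using h1⟩

/-- A customer and a server that are compatible, and have no compatible partners before each other,
are matched to each other. They can be removed without changing the rest of the matching. -/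
theorem serve_remove {c : C} {s : S} (hcs : (c, s) ∈ E) {t₁ : List S} (t₂ : List S) {u₁ : List C}
    (u₂ : List C) (hu : ∀ x ∈ u₁, (x, s) ∉ E) (ht : ∀ y ∈ t₁, (c, y) ∉ E) :
    serve E (t₁ ++ s :: t₂) (u₁ ++ c :: u₂) = serve E (t₁ ++ t₂) (u₁ ++ u₂) := by
  induction t₁ generalizing u₁ u₂ with
  | nil =>
    rw [List.nil_append, serve, if_pos ⟨c, by simp, hcs⟩,
      eraseP_append_cons (fun c => (c, s) ∈ E) hu hcs, List.nil_append]
  | cons y t₁ ih =>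
    have hy : (c, y) ∉ E := ht y (by simp)
    have ht' : ∀ y ∈ t₁, (c, y) ∉ E := fun y h => ht y (by simp [h])
    rw [List.cons_append, List.cons_append, serve, serve]
    by_cases h1 : ∃ x ∈ u₁, (x, y) ∈ E
    · obtain ⟨l, a, m, rfl, ha, hl⟩ := exists_first (fun x => (x, y) ∈ E) h1
      rw [if_pos ⟨a, by simp, ha⟩, if_pos ⟨a, by simp, ha⟩, List.append_assoc, List.append_assoc,
        List.cons_append, List.cons_append, eraseP_append_cons (fun c => (c, y) ∈ E) hl ha,
        eraseP_append_cons (fun c => (c, y) ∈ E) hl ha, ← List.append_assoc, ← List.append_assoc]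
      refine ih _ (fun x hx => hu x ?_) ht'
      rw [List.mem_append] at hx
      exact List.mem_append.2 (hx.imp_right (List.mem_cons_of_mem a))
    · push Not at h1
      by_cases h2 : ∃ x ∈ u₂, (x, y) ∈ E
      · obtain ⟨x, hx, hxy⟩ := h2
        rw [if_pos ⟨x, by simp [hx], hxy⟩, if_pos ⟨x, by simp [hx], hxy⟩,
          List.eraseP_append_right _ (by simpa using h1),
          List.eraseP_cons_of_neg (by simpa using hy),
          List.eraseP_append_right _ (by simpa using h1)]
        exact ih _ hu ht'
      · push Not at h2
        rw [if_neg, if_neg]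
        · rintro ⟨x, hx, hxy⟩
          exact (List.mem_append.1 hx).elim (fun h => h1 x h hxy) fun h => h2 x h hxy
        · rintro ⟨x, hx, hxy⟩
          rcases List.mem_append.1 hx with h | h
          · exact h1 x h hxy
          · rcases List.mem_cons.1 h with rfl | h
            · exact hy hxy
            · exact h2 x h hxy

theorem length_of_serve {ss : List S} {q q' : List C} (h : serve E ss q = some q') :
    q.length = ss.length + q'.length := by
  induction ss generalizing q with
  | nil => simp_all [serve]
  | cons s ss ih =>
    rw [serve] at h
    split_ifs at h with hs
    obtain ⟨l, a, m, rfl, ha, hl⟩ := exists_first _ hs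
    rw [eraseP_append_cons (fun c => (c, s) ∈ E) hl ha] at h
    have := ih h
    simp only [List.length_append, List.length_cons] at this ⊢
    omega

theorem mem_of_serve {ss : List S} {q q' : List C} (h : serve E ss q = some q') {c : C}
    (hc : c ∈ q) (hcs : ∀ s ∈ ss, (c, s) ∉ E) : c ∈ q' := by
  induction ss generalizing q with
  | nil => simp_all [serve]
  | cons s ss ih =>
    rw [serve] at h
    split_ifs at h with hs
    refine ih h ?_ fun s' hs' => hcs s' (List.mem_cons_of_mem _ hs')
    exact (List.mem_eraseP_of_neg (by simpa using hcs s (by simp))).2 hc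

theorem subset_of_serve {ss : List S} {q q' : List C} (h : serve E ss q = some q') : q' ⊆ q := by
  induction ss generalizing q with
  | nil => simp_all [serve]
  | cons s ss ih =>
    rw [serve] at h
    split_ifs at h with hs
    exact fun x hx => List.eraseP_subset (ih h hx)

end Serve

/-! ### Lines with exchanged items -/

section Unmatched

variable {A B : Type*}

/-- The types of the unmatched items on a line. -/
def unmatched (w : List (A ⊕ B)) : List A := w.filterMap Sum.getLeft?

@[simp] theorem unmatched_nil : unmatched ([] : List (A ⊕ B)) = [] := rfl

@[simp] theorem unmatched_cons_inl (a : A) (w : List (A ⊕ B)) :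
    unmatched (Sum.inl a :: w) = a :: unmatched w := rfl

@[simp] theorem unmatched_cons_inr (b : B) (w : List (A ⊕ B)) :
    unmatched (Sum.inr b :: w) = unmatched w := rfl

@[simp] theorem trim_cons_inr (b : B) (w : List (A ⊕ B)) :
    trim (Sum.inr b :: w) = trim w := rfl

theorem unmatched_append (v w : List (A ⊕ B)) :
    unmatched (v ++ w) = unmatched v ++ unmatched w := List.filterMap_append

@[simp] theorem unmatched_inl (l : List A) :
    unmatched (l.map (Sum.inl : A → A ⊕ B)) = l := by
  rw [unmatched, List.filterMap_map]
  exact List.filterMap_some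

@[simp] theorem unmatched_inr (l : List B) : unmatched (l.map (Sum.inr : B → A ⊕ B)) = [] := by
  simp [unmatched]

theorem exists_eq_map_inr {w : List (A ⊕ B)} (h : unmatched w = []) :
    ∃ l : List B, w = l.map Sum.inr := by
  induction w with
  | nil => exact ⟨[], rfl⟩
  | cons x w ih =>
    rcases x with a | b
    · simp [unmatched] at h
    · obtain ⟨l, rfl⟩ := ih (by simpa [unmatched] using h)
      exact ⟨b :: l, rfl⟩

theorem exists_first_unmatched (p : A → Prop) {w : List (A ⊕ B)} (h : ∃ a ∈ unmatched w, p a) :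
    ∃ X a Y, w = X ++ Sum.inl a :: Y ∧ p a ∧ ∀ x ∈ unmatched X, ¬ p x := by
  induction w with
  | nil => simp [unmatched] at h
  | cons x w ih =>
    by_cases hx : ∃ a, x = Sum.inl a ∧ p a
    · obtain ⟨a, rfl, ha⟩ := hx
      exact ⟨[], a, w, rfl, ha, by simp [unmatched]⟩
    · obtain ⟨X, a, Y, rfl, ha, hX⟩ := ih (by
        obtain ⟨a, ha, hpa⟩ := h
        refine ⟨a, ?_, hpa⟩
        rcases x with x | x
        · rcases List.mem_cons.1 ha with rfl | h
          · exact absurd ⟨_, rfl, hpa⟩ hx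
          · simpa [unmatched] using h
        · simpa [unmatched] using ha)
      refine ⟨x :: X, a, Y, rfl, ha, fun y hy => ?_⟩
      rcases x with x | x
      · rcases List.mem_cons.1 hy with rfl | h
        · exact fun hy => hx ⟨_, rfl, hy⟩
        · exact hX y (by simpa [unmatched] using h)
      · exact hX y (by simpa [unmatched] using hy)

variable (p : A → Prop) [DecidablePred p] (b : B)

theorem matchFirst_append_cons {X : List (A ⊕ B)} (Y : List (A ⊕ B)) {a : A}
    (hX : ∀ x ∈ unmatched X, ¬ p x) (ha : p a) :
    matchFirst p b (X ++ Sum.inl a :: Y) = some (a, X ++ Sum.inr b :: Y) := by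
  induction X with
  | nil => simp [matchFirst, ha]
  | cons x X ih =>
    rcases x with x | x
    · have hx : ¬ p x := hX x (by simp [unmatched])
      rw [List.cons_append, matchFirst, if_neg hx, ih fun y hy => hX y (by simp_all [unmatched])]
      rfl
    · rw [List.cons_append, matchFirst, ih fun y hy => hX y (by simp_all [unmatched])]
      rfl

theorem matchFirst_eq_none {w : List (A ⊕ B)} (h : ∀ x ∈ unmatched w, ¬ p x) :
    matchFirst p b w = none := by
  induction w with
  | nil => rfl
  | cons x w ih =>
    rcases x with x | x
    · have hx : ¬ p x := h x (by simp [unmatched])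
      rw [matchFirst, if_neg hx, ih fun y hy => h y (by simp_all [unmatched])]
      rfl
    · rw [matchFirst, ih fun y hy => h y (by simp_all [unmatched])]
      rfl

/-- Either no item on the line is compatible, or the first compatible item is exchanged. -/
theorem matchFirst_cases (w : List (A ⊕ B)) :
    ((∀ x ∈ unmatched w, ¬ p x) ∧ matchFirst p b w = none) ∨
      ∃ X a Y, w = X ++ Sum.inl a :: Y ∧ p a ∧ (∀ x ∈ unmatched X, ¬ p x) ∧
        matchFirst p b w = some (a, X ++ Sum.inr b :: Y) := by
  by_cases h : ∃ a ∈ unmatched w, p a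
  · obtain ⟨X, a, Y, rfl, ha, hX⟩ := exists_first_unmatched p h
    exact Or.inr ⟨X, a, Y, rfl, ha, hX, matchFirst_append_cons p b Y hX ha⟩
  · push Not at h
    exact Or.inl ⟨h, matchFirst_eq_none p b h⟩

theorem unmatched_append_inl_cons (X Y : List (A ⊕ B)) (a : A) :
    unmatched (X ++ Sum.inl a :: Y) = unmatched X ++ a :: unmatched Y := by
  rw [unmatched_append, unmatched_cons_inl]

theorem unmatched_append_inr_cons (X Y : List (A ⊕ B)) (b : B) :
    unmatched (X ++ Sum.inr b :: Y) = unmatched X ++ unmatched Y := by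
  rw [unmatched_append, unmatched_cons_inr]

theorem unmatched_trim (w : List (A ⊕ B)) : unmatched (trim w) = unmatched w := by
  induction w with
  | nil => rfl
  | cons x w ih =>
    rcases x with a | b
    · rfl
    · rwa [trim_cons_inr]

theorem trim_trim (w : List (A ⊕ B)) : trim (trim w) = trim w := by
  induction w with
  | nil => rfl
  | cons x w ih =>
    rcases x with a | b
    · rfl
    · rwa [trim_cons_inr]

theorem eq_nil_of_trim_eq {w : List (A ⊕ B)} (hw : trim w = w) (h : unmatched w = []) :
    w = [] := by
  obtain ⟨l, rfl⟩ := exists_eq_map_inr h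
  rw [← hw]
  simp [trim]

end Unmatched

theorem serve_cons_unmatched {C S : Type*} [DecidableEq C] [DecidableEq S]
    (E : Finset (C × S)) (s : S) (ss : List S) (W : List (C ⊕ S)) :
    serve E (s :: ss) (unmatched W) =
      (matchFirst (fun c => (c, s) ∈ E) s W).elim none fun r => serve E ss (unmatched r.2) := by
  rw [serve]
  rcases matchFirst_cases (fun c => (c, s) ∈ E) s W with ⟨h, hw⟩ | ⟨X, a, Y, rfl, ha, hX, hw⟩
  · rw [hw, if_neg]
    · rfl
    · push Not
      exact h
  · rw [hw, unmatched_append_inl_cons, if_pos ⟨a, by simp, ha⟩,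
      eraseP_append_cons (fun c => (c, s) ∈ E) hX ha, ← unmatched_append_inr_cons X Y s]
    rfl

/-! ### The line beyond the current word -/

section LineSum

variable {A B : Type*}

/-- The expected value of `F` on the line that begins with `w` and goes on with fresh items of
law `p`, summed over all lengths of the line. -/
noncomputable def lineSum (p : PMF A) (w : List (A ⊕ B)) (F : List (A ⊕ B) → ℝ≥0∞) : ℝ≥0∞ :=
  wordSum p fun l => F (w ++ l.map Sum.inl)

theorem lineSum_congr (p : PMF A) (w : List (A ⊕ B)) {F G : List (A ⊕ B) → ℝ≥0∞}
    (h : ∀ W, F W = G W) : lineSum p w F = lineSum p w G :=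
  wordSum_congr p fun _ => h _

theorem lineSum_headItem (p : PMF A) (w : List (A ⊕ B)) (F : List (A ⊕ B) → ℝ≥0∞)
    (hF : F [] = 0) :
    lineSum p w F = expect (MatchingModel.headItem p w) fun x =>
      lineSum p w.tail fun W => F (x :: W) := by
  cases w with
  | nil =>
    rw [lineSum, wordSum_eq, MatchingModel.headItem, expect_map]
    simp [hF, lineSum]
  | cons x w => rw [MatchingModel.headItem, expect_pure]; rfl

theorem expect_lineSum {σ : Type*} (p : PMF A) (w : List (A ⊕ B)) (q : PMF σ)
    (F : σ → List (A ⊕ B) → ℝ≥0∞) :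
    (expect q fun z => lineSum p w (F z)) = lineSum p w fun W => expect q fun z => F z W :=
  expect_wordSum p q _

end LineSum

namespace MatchingModel

variable {C S : Type*} [Fintype C] [DecidableEq C] [Fintype S] [DecidableEq S]
  (M : MatchingModel C S)

theorem mem_swap_E (c : C) (s : S) : (s, c) ∈ M.swap.E ↔ (c, s) ∈ M.E := by
  simp [swap]

theorem expect_seek (s : S) (w : List (C ⊕ S)) (F : List (C ⊕ S) → ℝ≥0∞) :
    (expect (M.seek s w) fun z => lineSum M.α z F) =
      lineSum M.α w fun W =>
        (matchFirst (fun c => (c, s) ∈ M.E) s W).elim 0 fun r => F r.2 := by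
  rcases matchFirst_cases (fun c => (c, s) ∈ M.E) s w with ⟨h, hw⟩ | ⟨X, a, Y, rfl, ha, hX, hw⟩
  · rw [seek, hw]
    dsimp only
    rw [expect_map]
    refine expect_failures_wordSum M.α _ _
      (fun l m => F (w ++ l.map Sum.inl ++ [Sum.inr s] ++ m.map Sum.inl)) _
      (fun l hl => ?_) fun l a m hl ha => ?_
    · dsimp only
      rw [matchFirst_eq_none]
      · rfl
      · intro x hx
        rw [unmatched_append, unmatched_inl, List.mem_append] at hx
        exact hx.elim (h x) (hl x)
    · dsimp only
      rw [List.map_append, List.map_cons, ← List.append_assoc,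
        matchFirst_append_cons (fun c => (c, s) ∈ M.E) _ _ _ ha]
      · simp
      · intro x hx
        rw [unmatched_append, unmatched_inl, List.mem_append] at hx
        exact hx.elim (h x) (hl x)
  · rw [seek, hw]
    dsimp only
    rw [expect_pure]
    refine wordSum_congr _ fun l => ?_
    dsimp only
    rw [List.append_assoc, List.cons_append, List.append_assoc, List.cons_append,
      matchFirst_append_cons (fun c => (c, s) ∈ M.E) _ _ hX ha]
    rfl

/-! ### The return probabilities of the natural and detailed chains -/

/-- The probability that the first come first served matching of the first `n` customers and the
first `n` servers is perfect. -/
noncomputable def perfectProb (n : ℕ) : ℝ≥0∞ :=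
  wordSum M.α fun cs => wordSum M.β fun ss =>
    if ss.length = n ∧ serve M.E ss cs = some [] then 1 else 0

/-- Pair by pair matching gives the same matching as server by server matching. -/
theorem pairStep_spec (c : C) (s : S) {p : List C} {q : List S}
    (hpq : ∀ x ∈ p, ∀ y ∈ q, (x, y) ∉ M.E) :
    (∀ x ∈ (M.pairStep c s (p, q)).1, ∀ y ∈ (M.pairStep c s (p, q)).2, (x, y) ∉ M.E) ∧
      ∀ cs ss, serve M.E (q ++ s :: ss) (p ++ c :: cs) =
        serve M.E ((M.pairStep c s (p, q)).2 ++ ss) ((M.pairStep c s (p, q)).1 ++ cs) := by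
  rw [pairStep]
  dsimp only
  by_cases hs : ∃ x ∈ p, (x, s) ∈ M.E
  · rw [if_pos hs]
    obtain ⟨p₁, x, p₂, rfl, hx, hp₁⟩ := exists_first (fun x => (x, s) ∈ M.E) hs
    have h1 : ∀ cs ss, serve M.E (q ++ s :: ss) ((p₁ ++ x :: p₂) ++ c :: cs) =
        serve M.E (q ++ ss) (p₁ ++ p₂ ++ c :: cs) := by
      intro cs ss
      rw [List.append_assoc, List.cons_append,
        serve_remove M.E hx _ _ hp₁ (hpq x (by simp)), List.append_assoc]
    rw [eraseP_append_cons (fun x => (x, s) ∈ M.E) hp₁ hx]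
    simp only [h1]
    have hpq' : ∀ z ∈ p₁ ++ p₂, ∀ y ∈ q, (z, y) ∉ M.E := fun z hz =>
      hpq z (by simp only [List.mem_append, List.mem_cons] at hz ⊢; tauto)
    by_cases hc : ∃ y ∈ q, (c, y) ∈ M.E
    · rw [if_pos hc]
      obtain ⟨q₁, y, q₂, rfl, hy, hq₁⟩ := exists_first (fun y => (c, y) ∈ M.E) hc
      rw [eraseP_append_cons (fun y => (c, y) ∈ M.E) hq₁ hy]
      refine ⟨fun z hz w hw => hpq' z hz w ?_, fun cs ss => ?_⟩
      · simp only [List.mem_append, List.mem_cons] at hw ⊢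
        tauto
      · rw [List.append_assoc q₁, List.cons_append,
          serve_remove M.E hy _ _ (fun z hz => hpq' z hz y (by simp)) hq₁, List.append_assoc q₁]
    · rw [if_neg hc]
      push Not at hc
      refine ⟨fun z hz w hw => ?_, fun cs ss => by simp⟩
      rcases List.mem_append.1 hz with h | h
      · exact hpq' z h w hw
      · rw [List.mem_singleton.1 h]
        exact hc w hw
  · rw [if_neg hs]
    push Not at hs
    by_cases hc : ∃ y ∈ q, (c, y) ∈ M.E
    · rw [if_pos hc]
      obtain ⟨q₁, y, q₂, rfl, hy, hq₁⟩ := exists_first (fun y => (c, y) ∈ M.E) hc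
      rw [eraseP_append_cons (fun y => (c, y) ∈ M.E) hq₁ hy]
      refine ⟨fun z hz w hw => ?_, fun cs ss => ?_⟩
      · rcases List.mem_append.1 hw with h | h
        · refine hpq z hz w ?_
          simp only [List.mem_append, List.mem_cons] at h ⊢
          tauto
        · rw [List.mem_singleton.1 h]
          exact hs z hz
      · rw [List.append_assoc q₁, List.cons_append,
          serve_remove M.E hy _ _ (fun z hz => hpq z hz y (by simp)) hq₁]
        simp
    · rw [if_neg hc]
      push Not at hc
      by_cases hcs : (c, s) ∈ M.E
      · rw [if_pos hcs]
        exact ⟨hpq, fun cs ss => serve_remove M.E hcs _ _ hs hc⟩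
      · rw [if_neg hcs]
        refine ⟨fun z hz w hw => ?_, fun cs ss => by simp⟩
        dsimp only at hz hw
        rcases List.mem_append.1 hz with h | h <;> rcases List.mem_append.1 hw with h' | h'
        · exact hpq z h w h'
        · rw [List.mem_singleton.1 h']
          exact hs z h
        · rw [List.mem_singleton.1 h]
          exact hc w h'
        · rw [List.mem_singleton.1 h, List.mem_singleton.1 h']
          exact hcs

theorem nStep_O_eq (n : ℕ) {p : List C} {q : List S} (hpq : ∀ x ∈ p, ∀ y ∈ q, (x, y) ∉ M.E) :
    nStep M.O n (p, q) ([], []) = wordSum M.α fun cs => wordSum M.β fun ss =>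
      if cs.length = n ∧ ss.length = n ∧ serve M.E (q ++ ss) (p ++ cs) = some [] then 1 else 0 := by
  induction n generalizing p q with
  | zero =>
    rw [wordSum_eq_nil, wordSum_eq_nil]
    · simp only [nStep, PMF.pure_apply, List.length_nil, List.append_nil, true_and]
      cases q with
      | nil => simp [serve, eq_comm]
      | cons y q =>
        have : serve M.E (y :: q) p = none := by
          rw [serve, if_neg]
          rintro ⟨x, hx, hxy⟩
          exact hpq x hx y (by simp) hxy
        simp [this]
    · intro ss hss
      simp [hss]
    · intro cs hcs
      simp [hcs, wordSum_zero]
  | succ n ih =>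
    rw [nStep_succ, O, expect_bind, wordSum_eq, List.length_nil]
    simp only [(Nat.succ_ne_zero n).symm, false_and, if_false, wordSum_zero, zero_add]
    refine expect_congr _ fun c _ => ?_
    simp only [expect_bind, expect_pure]
    have : ∀ cs : List C, (wordSum M.β fun ss =>
        if (c :: cs).length = n + 1 ∧ ss.length = n + 1 ∧
          serve M.E (q ++ ss) (p ++ c :: cs) = some [] then (1 : ℝ≥0∞) else 0) =
        expect M.β fun s => wordSum M.β fun ss => if cs.length = n ∧ ss.length = n ∧
          serve M.E ((M.pairStep c s (p, q)).2 ++ ss) ((M.pairStep c s (p, q)).1 ++ cs) = some []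
          then 1 else 0 := by
      intro cs
      rw [wordSum_eq]
      simp only [List.length_nil, (Nat.succ_ne_zero n).symm, false_and, and_false, if_false,
        zero_add]
      refine expect_congr _ fun s _ => wordSum_congr _ fun ss => ?_
      simp only [List.length_cons, Nat.add_right_cancel_iff, (M.pairStep_spec c s hpq).2]
    simp only [this]
    rw [← expect_wordSum]
    exact expect_congr _ fun s _ => ih (M.pairStep_spec c s hpq).1

theorem nStep_O (n : ℕ) : nStep M.O n ([], []) ([], []) = M.perfectProb n := by
  rw [M.nStep_O_eq n (by simp), perfectProb]
  refine wordSum_congr _ fun cs => wordSum_congr _ fun ss => ?_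
  refine if_congr (and_iff_right_of_imp ?_) rfl rfl
  rintro ⟨h1, h2⟩
  have := length_of_serve M.E h2
  simpa [h1] using this

theorem pairStep_swap (c : C) (s : S) (o : List C × List S) :
    M.swap.pairStep s c o.swap = (M.pairStep c s o).swap := by
  unfold pairStep
  simp only [Prod.fst_swap, Prod.snd_swap, mem_swap_E]
  split_ifs <;> rfl

theorem perfectProb_swap (n : ℕ) : M.swap.perfectProb n = M.perfectProb n := by
  rw [← nStep_O, ← nStep_O]
  refine nStep_eq_of_lump M.O M.swap.O Prod.swap Set.univ (by simp) (fun o _ => ?_)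
    (x₀ := ([], [])) (fun o _ h => Prod.swap_injective h) n (Set.mem_univ ([], []))
  rw [O, O, PMF.map_bind]
  simp only [PMF.map_bind, PMF.pure_map, ← pairStep_swap]
  rw [PMF.bind_comm]
  rfl

/-- The return probabilities of a chain of server by server matching, in which the line is cut by
`τ` after each step. The event that the chain goes from `z` to `y` by serving the servers in `ss`
on the line `W` is described by `K ss W`. -/
theorem nStep_seek (τ : List (C ⊕ S) → List (C ⊕ S)) (K : List S → List (C ⊕ S) → ℝ≥0∞)
    (y : List (C ⊕ S)) (hK : ∀ s ss W, K (s :: ss) W =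
      (matchFirst (fun c => (c, s) ∈ M.E) s W).elim 0 fun r => K ss r.2)
    (hKτ : ∀ ss z (l : List C), K ss (τ z ++ l.map Sum.inl) = K ss (z ++ l.map Sum.inl))
    (hK0 : ∀ z (l : List C), τ z = z →
      K [] (z ++ l.map Sum.inl) = if l = [] ∧ z = y then 1 else 0)
    (hτ : ∀ z, τ (τ z) = τ z) (n : ℕ) {z : List (C ⊕ S)} (hz : τ z = z) :
    nStep (fun z => M.β.bind fun s => (M.seek s z).map τ) n z y =
      wordSum M.β fun ss => if ss.length = n then lineSum M.α z (K ss) else 0 := by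
  induction n generalizing z with
  | zero =>
    rw [wordSum_eq_nil _ (by simp +contextual), lineSum,
      wordSum_congr _ fun l => hK0 z l hz, wordSum_eq_nil _ (by simp +contextual)]
    simp [nStep, PMF.pure_apply, eq_comm]
  | succ n ih =>
    rw [nStep_succ, expect_bind, wordSum_eq]
    simp only [List.length_nil, (Nat.succ_ne_zero n).symm, if_false, zero_add]
    refine expect_congr _ fun s _ => ?_
    rw [expect_map, expect_congr _ fun z' _ => ih (hτ z'), expect_wordSum]
    refine wordSum_congr _ fun ss => ?_
    simp only [List.length_cons, Nat.add_right_cancel_iff]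
    split_ifs
    · rw [lineSum_congr _ _ (hK s ss), ← expect_seek]
      exact expect_congr _ fun z' _ => wordSum_congr _ fun l => hKτ ss z' l
    · exact (expect_const _ _)

theorem nStep_Zs (n : ℕ) : nStep M.Zs n [] [] = M.perfectProb n := by
  have := M.nStep_seek trim
    (fun ss W => if serve M.E ss (unmatched W) = some [] then 1 else 0) [] ?_ ?_ ?_ trim_trim n
    (z := []) rfl
  · rw [show M.Zs = fun z => M.β.bind fun s => (M.seek s z).map trim from rfl, this, perfectProb,
      wordSum_comm]
    refine wordSum_congr _ fun ss => ?_
    by_cases h : ss.length = n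
    · simp [lineSum, h]
    · simp [h, wordSum_zero]
  · intro s ss W
    rw [serve_cons_unmatched]
    cases matchFirst (fun c => (c, s) ∈ M.E) s W <;> rfl
  · intro ss z l
    rw [unmatched_append, unmatched_append, unmatched_trim]
  · intro z l hz
    refine if_congr ?_ rfl rfl
    rw [serve, unmatched_append, unmatched_inl, Option.some_inj, List.append_eq_nil_iff, and_comm]
    exact and_congr_right fun _ => ⟨eq_nil_of_trim_eq hz, fun h => by simp [h]⟩

theorem nStep_Qs (n : ℕ) : nStep M.Qs n [] [] = M.perfectProb n := by
  rw [← nStep_Zs]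
  refine nStep_eq_of_lump M.Zs M.Qs unmatched {z | trim z = z} (fun z _ y hy => ?_)
    (fun z _ => ?_) (x₀ := []) (fun z hz h => eq_nil_of_trim_eq hz h) n (x := []) rfl
  · rw [Zs, ← PMF.mem_support_iff, PMF.mem_support_bind_iff] at hy
    obtain ⟨s, -, hy⟩ := hy
    rw [PMF.mem_support_map_iff] at hy
    obtain ⟨z', -, rfl⟩ := hy
    exact trim_trim z'
  · rw [Zs, Qs, PMF.map_bind]
    congr 1
    funext s
    rw [PMF.map_comp, seek]
    have hcomp : (unmatched ∘ trim : List (C ⊕ S) → List C) = unmatched :=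
      funext unmatched_trim
    rw [hcomp]
    rcases matchFirst_cases (fun c => (c, s) ∈ M.E) s z with ⟨h, hw⟩ | ⟨X, a, Y, rfl, ha, hX, hw⟩
    · rw [hw, if_neg (by push Not; exact h)]
      dsimp only
      rw [PMF.map_comp]
      congr 1
      funext l
      simp [unmatched_append]
    · rw [hw, if_pos ⟨a, by simp [unmatched_append_inl_cons], ha⟩]
      dsimp only
      rw [PMF.pure_map, unmatched_append_inl_cons, unmatched_append_inr_cons,
        eraseP_append_cons (fun c => (c, s) ∈ M.E) hX ha]

theorem unmatched_backwardStep (c : C) (s : S) (d : List (C ⊕ S) × List (S ⊕ C)) :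
    (unmatched (M.backwardStep c s d).1, unmatched (M.backwardStep c s d).2) =
      M.pairStep c s (unmatched d.1, unmatched d.2) := by
  obtain ⟨z, v⟩ := d
  rw [backwardStep, pairStep]
  dsimp only
  rcases matchFirst_cases (fun x => (x, s) ∈ M.E) s z with
    ⟨h, hw⟩ | ⟨X, a, Y, rfl, ha, hX, hw⟩ <;>
  rcases matchFirst_cases (fun y => (c, y) ∈ M.E) c v with
    ⟨h', hw'⟩ | ⟨X', a', Y', rfl, ha', hX', hw'⟩
  · have h1 : ¬ ∃ x ∈ unmatched z, (x, s) ∈ M.E := by push Not; exact h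
    have h2 : ¬ ∃ y ∈ unmatched v, (c, y) ∈ M.E := by push Not; exact h'
    simp only [hw, hw', h1, h2, if_false]
    by_cases hcs : (c, s) ∈ M.E <;> simp [hcs, unmatched_trim, unmatched_append]
  · have h1 : ¬ ∃ x ∈ unmatched z, (x, s) ∈ M.E := by push Not; exact h
    have h2 : ∃ y ∈ unmatched (X' ++ Sum.inl a' :: Y'), (c, y) ∈ M.E :=
      ⟨a', by simp [unmatched_append_inl_cons], ha'⟩
    simp only [hw, hw', h1, h2, if_false, if_true, unmatched_trim]
    rw [unmatched_append_inl_cons X' Y' a', eraseP_append_cons (fun y => (c, y) ∈ M.E) hX' ha']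
    simp [unmatched_append]
  · have h1 : ∃ x ∈ unmatched (X ++ Sum.inl a :: Y), (x, s) ∈ M.E :=
      ⟨a, by simp [unmatched_append_inl_cons], ha⟩
    have h2 : ¬ ∃ y ∈ unmatched v, (c, y) ∈ M.E := by push Not; exact h'
    simp only [hw, hw', h1, h2, if_false, if_true, unmatched_trim]
    rw [unmatched_append_inl_cons X Y a, eraseP_append_cons (fun x => (x, s) ∈ M.E) hX ha]
    simp [unmatched_append]
  · have h1 : ∃ x ∈ unmatched (X ++ Sum.inl a :: Y), (x, s) ∈ M.E :=
      ⟨a, by simp [unmatched_append_inl_cons], ha⟩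
    have h2 : ∃ y ∈ unmatched (X' ++ Sum.inl a' :: Y'), (c, y) ∈ M.E :=
      ⟨a', by simp [unmatched_append_inl_cons], ha'⟩
    simp only [hw, hw', h1, h2, if_true, unmatched_trim]
    rw [unmatched_append_inl_cons X Y a, unmatched_append_inl_cons X' Y' a',
      eraseP_append_cons (fun x => (x, s) ∈ M.E) hX ha,
      eraseP_append_cons (fun y => (c, y) ∈ M.E) hX' ha']
    simp [unmatched_append]

theorem trim_backwardStep (c : C) (s : S) (d : List (C ⊕ S) × List (S ⊕ C)) :
    trim (M.backwardStep c s d).1 = (M.backwardStep c s d).1 ∧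
      trim (M.backwardStep c s d).2 = (M.backwardStep c s d).2 := by
  unfold backwardStep
  split <;> (try split_ifs) <;> exact ⟨trim_trim _, trim_trim _⟩

theorem nStep_D (n : ℕ) : nStep M.D n ([], []) ([], []) = M.perfectProb n := by
  rw [← nStep_O]
  refine (nStep_eq_of_lump M.D M.O (fun d => (unmatched d.1, unmatched d.2))
    {d | trim d.1 = d.1 ∧ trim d.2 = d.2} (fun d _ y hy => ?_) (fun d _ => ?_) (x₀ := ([], []))
    (fun d hd h => ?_) n (x := ([], [])) ⟨rfl, rfl⟩).symm
  · rw [D, ← PMF.mem_support_iff, PMF.mem_support_bind_iff] at hy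
    obtain ⟨c, -, hy⟩ := hy
    rw [PMF.mem_support_bind_iff] at hy
    obtain ⟨s, -, hy⟩ := hy
    rw [PMF.mem_support_pure_iff] at hy
    rw [hy]
    exact M.trim_backwardStep c s d
  · simp only [D, O, PMF.map_bind, PMF.pure_map, unmatched_backwardStep]
  · rw [Prod.mk.injEq] at h
    exact Prod.ext (eq_nil_of_trim_eq hd.1 h.1) (eq_nil_of_trim_eq hd.2 h.2)

/-- The forward matching of two lines of length `n` ends with all items matched. -/
noncomputable def forwardPerfect (n : ℕ) (W : List (C ⊕ S)) (V : List (S ⊕ C)) : ℝ≥0∞ :=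
  if W.length = n ∧ V.length = n ∧ serve M.E (unmatched V) (unmatched W) = some [] then 1 else 0

theorem forwardPerfect_inl_inl_of_mem {c : C} {s : S} (h : (c, s) ∈ M.E) (n : ℕ)
    (W : List (C ⊕ S)) (V : List (S ⊕ C)) :
    M.forwardPerfect (n + 1) (Sum.inl c :: W) (Sum.inl s :: V) = M.forwardPerfect n W V := by
  have := serve_remove M.E h (t₁ := []) (unmatched V) (u₁ := []) (unmatched W) (by simp) (by simp)
  simp only [List.nil_append] at this
  simp [forwardPerfect, this]

theorem forwardPerfect_inr_inr (c : C) (s : S) (n : ℕ) (W : List (C ⊕ S)) (V : List (S ⊕ C)) :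
    M.forwardPerfect (n + 1) (Sum.inr s :: W) (Sum.inr c :: V) = M.forwardPerfect n W V := by
  simp [forwardPerfect]

theorem forwardPerfect_inr_inl (s s' : S) (n : ℕ) (W : List (C ⊕ S)) (V : List (S ⊕ C)) :
    M.forwardPerfect (n + 1) (Sum.inr s' :: W) (Sum.inl s :: V) =
      (matchFirst (fun c => (c, s) ∈ M.E) s W).elim 0 fun r => M.forwardPerfect n r.2 V := by
  simp only [forwardPerfect, unmatched_cons_inl, unmatched_cons_inr, serve_cons_unmatched]
  rcases matchFirst_cases (fun c => (c, s) ∈ M.E) s W with ⟨-, hw⟩ | ⟨X, a, Y, rfl, -, -, hw⟩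
  · simp [hw]
  · simp [hw]

/-- A customer at the head of the line, which no earlier server could take, takes the first
compatible server. -/
theorem serve_cons_customer (c : C) (p : List C) (V : List (S ⊕ C)) :
    serve M.E (unmatched V) (c :: p) = some [] ↔
      ∃ r ∈ matchFirst (fun y => (y, c) ∈ M.swap.E) c V,
        serve M.E (unmatched r.2) p = some [] := by
  rcases matchFirst_cases (fun y => (y, c) ∈ M.swap.E) c V with
    ⟨h, hw⟩ | ⟨X, a, Y, rfl, ha, hX, hw⟩
  · simp only [hw, Option.mem_def, reduceCtorEq, false_and, exists_false, iff_false]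
    intro hs
    have := mem_of_serve M.E hs (c := c) (by simp) fun y hy => (M.mem_swap_E c y).not.1 (h y hy)
    simp at this
  · simp only [hw, Option.mem_def, Option.some.injEq, exists_eq_left', unmatched_append_inl_cons,
      unmatched_append_inr_cons]
    have := serve_remove M.E ((M.mem_swap_E c a).1 ha) (unmatched Y) (u₁ := []) p (by simp)
      (t₁ := unmatched X) fun y hy => (M.mem_swap_E c y).not.1 (hX y hy)
    simp only [List.nil_append] at this
    rw [this]

theorem forwardPerfect_inl_inr (c c' : C) (n : ℕ) (W : List (C ⊕ S)) (V : List (S ⊕ C)) :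
    M.forwardPerfect (n + 1) (Sum.inl c :: W) (Sum.inr c' :: V) =
      (matchFirst (fun y => (y, c) ∈ M.swap.E) c V).elim 0 fun r =>
        M.forwardPerfect n W r.2 := by
  simp only [forwardPerfect, unmatched_cons_inl, unmatched_cons_inr, serve_cons_customer]
  rcases matchFirst_cases (fun y => (y, c) ∈ M.swap.E) c V with
    ⟨-, hw⟩ | ⟨X, a, Y, rfl, -, -, hw⟩
  · simp [hw]
  · simp [hw]

theorem forwardPerfect_inl_inl {c : C} {s : S} (h : (c, s) ∉ M.E) (n : ℕ)
    (W : List (C ⊕ S)) (V : List (S ⊕ C)) :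
    M.forwardPerfect (n + 1) (Sum.inl c :: W) (Sum.inl s :: V) =
      (matchFirst (fun c => (c, s) ∈ M.E) s W).elim 0 fun r =>
        (matchFirst (fun y => (y, c) ∈ M.swap.E) c V).elim 0 fun r' =>
          M.forwardPerfect n r.2 r'.2 := by
  have hswap := M.forwardPerfect_inl_inr c c n
  rcases matchFirst_cases (fun c => (c, s) ∈ M.E) s W with ⟨hn, hw⟩ | ⟨X, a, Y, rfl, ha, hX, hw⟩
  · rw [hw, forwardPerfect, if_neg]
    · rfl
    · rintro ⟨-, -, h3⟩
      rw [unmatched_cons_inl, unmatched_cons_inl, serve, if_neg] at h3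
      · simp at h3
      · rintro ⟨x, hx, hxs⟩
        rcases List.mem_cons.1 hx with rfl | hx
        · exact h hxs
        · exact hn x hx hxs
  · rw [hw, Option.elim_some, ← hswap]
    have := serve_remove M.E ha (t₁ := []) (unmatched V) (u₁ := c :: unmatched X) (unmatched Y)
      (by
        intro x hx
        rcases List.mem_cons.1 hx with rfl | hx
        · exact h
        · exact hX x hx) (by simp)
    simp only [List.nil_append, List.cons_append] at this
    simp [forwardPerfect, unmatched_append_inl_cons, unmatched_append_inr_cons, this]

theorem nStep_forward_eq (n : ℕ) (w : List (C ⊕ S)) (v : List (S ⊕ C)) :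
    nStep M.forward n (w, v) ([], []) =
      lineSum M.α w fun W => lineSum M.β v fun V => M.forwardPerfect n W V := by
  induction n generalizing w v with
  | zero =>
    rw [lineSum, wordSum_eq_nil, lineSum, wordSum_eq_nil]
    · by_cases hw : w = [] <;> by_cases hv : v = [] <;>
        simp [nStep, PMF.pure_apply, forwardPerfect, hw, hv, serve, eq_comm (b := w),
          eq_comm (b := v)]
    · intro m hm
      simp [forwardPerfect, hm]
    · intro m hm
      simp [forwardPerfect, hm, lineSum, wordSum_zero]
  | succ n ih =>
    rw [nStep_succ, forward, expect_bind, lineSum_headItem]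
    swap
    · simp [forwardPerfect, lineSum, wordSum_zero]
    refine expect_congr _ fun x _ => ?_
    have h1 : ∀ W, (lineSum M.β v fun V => M.forwardPerfect (n + 1) (x :: W) V) =
        expect (headItem M.β v) fun y => lineSum M.β v.tail fun V =>
          M.forwardPerfect (n + 1) (x :: W) (y :: V) := fun W =>
      lineSum_headItem _ _ _ (by simp [forwardPerfect])
    rw [lineSum_congr _ _ h1, ← expect_lineSum, expect_bind]
    refine expect_congr _ fun y _ => ?_
    have hseek : ∀ s z' v', (expect (M.seek s z') fun z => nStep M.forward n (z, v') ([], [])) =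
        lineSum M.α z' fun W => lineSum M.β v' fun V =>
          (matchFirst (fun c => (c, s) ∈ M.E) s W).elim 0 fun r => M.forwardPerfect n r.2 V := by
      intro s z' v'
      simp only [ih]
      rw [expect_seek]
      refine lineSum_congr _ _ fun W => ?_
      cases matchFirst (fun c => (c, s) ∈ M.E) s W
      · simp [lineSum, wordSum_zero]
      · rfl
    have hseek' : ∀ c w' (F : List (S ⊕ C) → ℝ≥0∞),
        (expect (M.swap.seek c w') fun z => lineSum M.β z F) =
        lineSum M.β w' fun W =>
          (matchFirst (fun y => (y, c) ∈ M.swap.E) c W).elim 0 fun r => F r.2 :=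
      fun c w' F => M.swap.expect_seek c w' F
    rcases x with c | s' <;> rcases y with s | c'
    · by_cases hcs : (c, s) ∈ M.E
      · simp only [hcs, if_true, expect_pure, ih, M.forwardPerfect_inl_inl_of_mem hcs]
      · simp only [hcs, if_false, expect_bind, expect_map]
        simp only [M.forwardPerfect_inl_inl hcs]
        have h2 : ∀ z, (expect (M.swap.seek c v.tail) fun v' =>
            nStep M.forward n (z, v') ([], [])) = lineSum M.α z fun W => lineSum M.β v.tail fun V =>
              (matchFirst (fun y => (y, c) ∈ M.swap.E) c V).elim 0 fun r' =>
                M.forwardPerfect n W r'.2 := by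
          intro z
          simp only [ih, expect_lineSum, hseek']
        simp only [h2]
        rw [expect_seek]
        refine lineSum_congr _ _ fun W => ?_
        cases matchFirst (fun c => (c, s) ∈ M.E) s W
        · simp [lineSum, wordSum_zero]
        · rfl
    · simp only [expect_map, ih, expect_lineSum, hseek', M.forwardPerfect_inl_inr]
    · simp only [expect_map, hseek, M.forwardPerfect_inr_inl]
    · simp only [expect_pure, ih, M.forwardPerfect_inr_inr]

theorem nStep_forward (n : ℕ) : nStep M.forward n ([], []) ([], []) = M.perfectProb n := by
  rw [nStep_forward_eq, perfectProb]
  refine wordSum_congr _ fun cs => wordSum_congr _ fun ss => ?_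
  simp only [forwardPerfect, List.nil_append, unmatched_inl, List.length_map]
  refine if_congr (and_iff_right_of_imp ?_) rfl rfl
  rintro ⟨h1, h2⟩
  have := length_of_serve M.E h2
  simpa [h1] using this

end MatchingModel

/-! ### Serving servers on a line with exchange -/

section ServeLine

variable {C S : Type*} [DecidableEq C] [DecidableEq S] (E : Finset (C × S))

/-- The line after servers of the given types have been matched, one after the other, and
exchanged with the first compatible unmatched customer; `none` if some server does not find one. -/
def serveLine : List S → List (C ⊕ S) → Option (List (C ⊕ S))
  | [], W => some W
  | s :: ss, W => (matchFirst (fun c => (c, s) ∈ E) s W).elim none fun r => serveLine ss r.2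

theorem serve_unmatched (ss : List S) (W : List (C ⊕ S)) :
    serve E ss (unmatched W) = (serveLine E ss W).map unmatched := by
  induction ss generalizing W with
  | nil => rfl
  | cons s ss ih =>
    rw [serve_cons_unmatched, serveLine]
    cases matchFirst (fun c => (c, s) ∈ E) s W with
    | none => rfl
    | some r => exact ih r.2

theorem serveLine_append (ss ss' : List S) (W : List (C ⊕ S)) :
    serveLine E (ss ++ ss') W = (serveLine E ss W).bind (serveLine E ss') := by
  induction ss generalizing W with
  | nil => rfl
  | cons s ss ih =>
    rw [List.cons_append, serveLine, serveLine]
    cases matchFirst (fun c => (c, s) ∈ E) s W with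
    | none => rfl
    | some r => exact ih r.2

theorem serveLine_append_line {ss : List S} {A A' : List (C ⊕ S)} (B : List (C ⊕ S))
    (h : serveLine E ss A = some A') : serveLine E ss (A ++ B) = some (A' ++ B) := by
  induction ss generalizing A with
  | nil => simp_all [serveLine]
  | cons s ss ih =>
    rw [serveLine] at h ⊢
    rcases matchFirst_cases (fun c => (c, s) ∈ E) s A with ⟨-, hw⟩ | ⟨X, a, Y, rfl, ha, hX, hw⟩
    · simp [hw] at h
    · rw [hw] at h
      rw [List.append_assoc, List.cons_append,
        matchFirst_append_cons (fun c => (c, s) ∈ E) _ _ hX ha]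
      have := ih h
      rwa [List.append_assoc, List.cons_append] at this

theorem matchFirst_inr_append {A B : Type*} (p : A → Prop) [DecidablePred p] (b : B) (l : List B)
    (W : List (A ⊕ B)) : matchFirst p b (l.map Sum.inr ++ W) =
      (matchFirst p b W).map fun r => (r.1, l.map Sum.inr ++ r.2) := by
  induction l with
  | nil => simp
  | cons x l ih =>
    rw [List.map_cons, List.cons_append, matchFirst, ih, Option.map_map]
    rfl

theorem serveLine_inr_append (ss : List S) (l : List S) (W : List (C ⊕ S)) :
    serveLine E ss (l.map Sum.inr ++ W) = (serveLine E ss W).map fun W' => l.map Sum.inr ++ W' := by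
  induction ss generalizing W with
  | nil => rfl
  | cons s ss ih =>
    rw [serveLine, serveLine, matchFirst_inr_append]
    cases matchFirst (fun c => (c, s) ∈ E) s W with
    | none => rfl
    | some r => exact ih r.2

theorem serveLine_of_forall₂ {cs : List C} {ss : List S}
    (h : List.Forall₂ (fun c s => (c, s) ∈ E) cs ss) :
    serveLine E ss (cs.map Sum.inl) = some (ss.map Sum.inr) := by
  induction h with
  | nil => rfl
  | @cons c s cs ss hcs _ ih =>
    rw [serveLine, List.map_cons, matchFirst, if_pos hcs, Option.elim_some]
    have := serveLine_inr_append E ss [s] (cs.map Sum.inl)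
    rw [ih] at this
    exact this

theorem exists_serveLine_of_serve {ss : List S} {cs : List C} (h : serve E ss cs = some []) :
    ∃ v : List S, serveLine E ss (cs.map Sum.inl) = some (v.map Sum.inr) := by
  have h' := serve_unmatched E ss (cs.map Sum.inl)
  rw [unmatched_inl, h] at h'
  obtain ⟨W, hW, hu⟩ := Option.map_eq_some_iff.1 h'.symm
  obtain ⟨v, rfl⟩ := exists_eq_map_inr hu
  exact ⟨v, hW⟩

/-- Customers that are unmatched at the end play no role for the matching before them. -/
theorem exists_of_serveLine_eq_append {ss : List S} {W A' : List (C ⊕ S)} {u : List C}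
    (h : serveLine E ss W = some (A' ++ u.map Sum.inl)) :
    ∃ A, W = A ++ u.map Sum.inl ∧ serveLine E ss A = some A' := by
  induction ss generalizing W with
  | nil => exact ⟨A', by simpa [serveLine] using h, rfl⟩
  | cons s ss ih =>
    rw [serveLine] at h
    rcases matchFirst_cases (fun c => (c, s) ∈ E) s W with ⟨-, hw⟩ | ⟨X, a, Y, rfl, ha, hX, hw⟩
    · simp [hw] at h
    · rw [hw] at h
      obtain ⟨A, hA, hr⟩ := ih h
      dsimp only at hA
      obtain ⟨Z, rfl, rfl⟩ : ∃ Z, A = X ++ Sum.inr s :: Z ∧ Y = Z ++ u.map Sum.inl := by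
        rcases List.append_eq_append_iff.1 hA with ⟨D, rfl, hD⟩ | ⟨D, rfl, hD⟩
        · rcases List.cons_eq_append_iff.1 hD with ⟨-, hD'⟩ | ⟨Z, rfl, rfl⟩
          · have : (Sum.inr s : C ⊕ S) ∈ u.map Sum.inl := by simp [hD']
            simp at this
          · exact ⟨Z, rfl, rfl⟩
        · have : (Sum.inr s : C ⊕ S) ∈ u.map Sum.inl := by simp [hD]
          simp at this
      refine ⟨X ++ Sum.inl a :: Z, by simp, ?_⟩
      rw [serveLine, matchFirst_append_cons (fun c => (c, s) ∈ E) _ _ hX ha]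
      exact hr

end ServeLine

/-! ### Cutting the line in the augmented chains -/

section TrimAug

variable {A B : Type*}

/-- The types of the exchanged items on a line. -/
def exchanged (w : List (A ⊕ B)) : List B := w.filterMap Sum.getRight?

theorem exchanged_append (v w : List (A ⊕ B)) :
    exchanged (v ++ w) = exchanged v ++ exchanged w := List.filterMap_append

@[simp] theorem exchanged_cons_inl (a : A) (w : List (A ⊕ B)) :
    exchanged (Sum.inl a :: w) = exchanged w := rfl

@[simp] theorem exchanged_cons_inr (b : B) (w : List (A ⊕ B)) :
    exchanged (Sum.inr b :: w) = b :: exchanged w := rfl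

@[simp] theorem exchanged_inr (l : List B) : exchanged (l.map (Sum.inr : B → A ⊕ B)) = l := by
  induction l with
  | nil => rfl
  | cons b l ih => rw [List.map_cons, exchanged_cons_inr, ih]

@[simp] theorem exchanged_inl (l : List A) : exchanged (l.map (Sum.inl : A → A ⊕ B)) = [] := by
  induction l with
  | nil => rfl
  | cons b l ih => rw [List.map_cons, exchanged_cons_inl, ih]

variable [DecidableEq A] [DecidableEq B]

theorem trimAug_cons_inr (b : B) (w : List (A ⊕ B)) :
    trimAug (Sum.inr b :: w) = if b ∈ exchanged w then trimAug w else Sum.inr b :: w := rfl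

theorem trimAug_inr_append {l : List B} {w : List (A ⊕ B)} (h : ∀ b ∈ l, b ∈ exchanged w) :
    trimAug (l.map Sum.inr ++ w) = trimAug w := by
  induction l with
  | nil => rfl
  | cons b l ih =>
    rw [List.map_cons, List.cons_append, trimAug_cons_inr, if_pos]
    · exact ih fun x hx => h x (List.mem_cons_of_mem _ hx)
    · rw [exchanged_append]
      exact List.mem_append_right _ (h b (by simp))

theorem exists_eq_append_trimAug (w : List (A ⊕ B)) :
    ∃ l : List B, w = l.map Sum.inr ++ trimAug w ∧ ∀ b ∈ l, b ∈ exchanged (trimAug w) := by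
  induction w with
  | nil => exact ⟨[], rfl, by simp⟩
  | cons x w ih =>
    rcases x with a | b
    · exact ⟨[], rfl, by simp⟩
    · rw [trimAug_cons_inr]
      split_ifs with hb
      · obtain ⟨l, hl, hl'⟩ := ih
        refine ⟨b :: l, by rw [List.map_cons, List.cons_append, ← hl], fun x hx => ?_⟩
        rcases List.mem_cons.1 hx with rfl | hx
        · rw [hl, exchanged_append, exchanged_inr, List.mem_append] at hb
          exact hb.elim (hl' x) id
        · exact hl' x hx
      · exact ⟨[], rfl, by simp⟩

theorem trimAug_trimAug (w : List (A ⊕ B)) : trimAug (trimAug w) = trimAug w := by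
  induction w with
  | nil => rfl
  | cons x w ih =>
    rcases x with a | b
    · rfl
    · rw [trimAug_cons_inr]
      split_ifs with hb
      · exact ih
      · rw [trimAug_cons_inr, if_neg hb]

theorem unmatched_trimAug (w : List (A ⊕ B)) : unmatched (trimAug w) = unmatched w := by
  obtain ⟨l, hl, -⟩ := exists_eq_append_trimAug w
  conv_rhs => rw [hl, unmatched_append, unmatched_inr, List.nil_append]

end TrimAug

section Augmented

variable {C S : Type*} [DecidableEq C] [DecidableEq S] (E : Finset (C × S))

theorem exchanged_subset_of_serveLine {ss : List S} {W W' : List (C ⊕ S)}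
    (h : serveLine E ss W = some W') :
    exchanged W ⊆ exchanged W' := by
  induction ss generalizing W with
  | nil => simp_all [serveLine]
  | cons s ss ih =>
    rw [serveLine] at h
    rcases matchFirst_cases (fun c => (c, s) ∈ E) s W with ⟨-, hw⟩ | ⟨X, a, Y, rfl, ha, hX, hw⟩
    · simp [hw] at h
    · rw [hw] at h
      intro x hx
      refine ih h ?_
      simp only [exchanged_append, exchanged_cons_inl, exchanged_cons_inr, List.mem_append,
        List.mem_cons] at hx ⊢
      tauto

/-- The deleted exchanged items have no influence on later states. -/
theorem map_trimAug_serveLine (ss : List S) (z L : List (C ⊕ S)) :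
    (serveLine E ss (trimAug z ++ L)).map trimAug = (serveLine E ss (z ++ L)).map trimAug := by
  obtain ⟨l, hl, hl'⟩ := exists_eq_append_trimAug z
  conv_rhs => rw [hl, List.append_assoc, serveLine_inr_append, Option.map_map]
  cases h : serveLine E ss (trimAug z ++ L) with
  | none => rfl
  | some W =>
    have := exchanged_subset_of_serveLine E h
    rw [Option.map_some, Option.map_some, Function.comp_apply, trimAug_inr_append]
    intro b hb
    refine this ?_
    rw [exchanged_append]
    exact List.mem_append_left _ (hl' b hb)

/-- The indicator of the event that serving `ss` on the line `W` leads to the state `y` of an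
augmented chain. -/
noncomputable def reaches (y : List (C ⊕ S)) (ss : List S) (W : List (C ⊕ S)) : ℝ≥0∞ :=
  if (serveLine E ss W).map trimAug = some y then 1 else 0

theorem reaches_cons (y : List (C ⊕ S)) (s : S) (ss : List S) (W : List (C ⊕ S)) :
    reaches E y (s :: ss) W =
      (matchFirst (fun c => (c, s) ∈ E) s W).elim 0 fun r => reaches E y ss r.2 := by
  rw [reaches, serveLine]
  cases matchFirst (fun c => (c, s) ∈ E) s W <;> simp [reaches]

theorem reaches_trimAug (y : List (C ⊕ S)) (ss : List S) (z L : List (C ⊕ S)) :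
    reaches E y ss (trimAug z ++ L) = reaches E y ss (z ++ L) := by
  rw [reaches, reaches, map_trimAug_serveLine]

theorem reaches_eq_zero {y : List (C ⊕ S)} {ss : List S} {W : List (C ⊕ S)} {c : C}
    (hy : c ∈ unmatched y) (hW : c ∉ unmatched W) : reaches E y ss W = 0 := by
  rw [reaches, if_neg]
  intro h
  obtain ⟨W', hr, rfl⟩ := Option.map_eq_some_iff.1 h
  rw [unmatched_trimAug] at hy
  exact hW (subset_of_serve E (by rw [serve_unmatched, hr]; rfl) hy)

end Augmented

namespace MatchingModel

variable {C S : Type*} [Fintype C] [DecidableEq C] [Fintype S] [DecidableEq S]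
  (M : MatchingModel C S)

/-- The probability to get from `x` to `y` in `n` steps of server by server matching with
exchange, when all states are cut as in the augmented chains. -/
noncomputable def reachProb (n : ℕ) (x y : List (C ⊕ S)) : ℝ≥0∞ :=
  wordSum M.β fun ss => if ss.length = n then lineSum M.α x (reaches M.E y ss) else 0

theorem nStep_Zaug (n : ℕ) {x : List (C ⊕ S)} (hx : trimAug x = x) (v : List S) :
    nStep M.Zaug n x (v.map Sum.inr) = M.reachProb n x (v.map Sum.inr) := by
  refine M.nStep_seek trimAug (reaches M.E (v.map Sum.inr)) _ (reaches_cons M.E _)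
    (fun ss z l => reaches_trimAug M.E _ ss z _) (fun z l hz => ?_) trimAug_trimAug n hx
  refine if_congr ?_ rfl rfl
  rw [serveLine, Option.map_some, Option.some_inj]
  constructor
  · intro h
    have h' := congrArg unmatched h
    rw [unmatched_trimAug, unmatched_append, unmatched_inl, unmatched_inr,
      List.append_eq_nil_iff] at h'
    obtain ⟨-, rfl⟩ := h'
    rw [List.map_nil, List.append_nil, hz] at h
    exact ⟨rfl, h⟩
  · rintro ⟨rfl, rfl⟩
    rw [List.map_nil, List.append_nil, hz]

/-- The word contains all types, and no shorter initial part does. -/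
def IsMinimalCover {A : Type*} (l : List A) : Prop :=
  (∀ a, a ∈ l) ∧ ∃ u a, l = u ++ [a] ∧ a ∉ u

theorem expect_revealUntil (c : C) (w : List (C ⊕ S)) (F : List (C ⊕ S) → ℝ≥0∞)
    (hF : ∀ l : List C, c ∉ l → F (w ++ l.map Sum.inl) = 0) :
    (expect (M.revealUntil c w) fun z => lineSum M.α z F) = lineSum M.α w F := by
  rw [revealUntil, expect_map]
  refine expect_failures_wordSum M.α _ _
    (fun l m => F (w ++ l.map Sum.inl ++ [Sum.inl c] ++ m.map Sum.inl)) _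
    (fun l hl => hF l fun hc => hl c hc rfl) fun l a m _ ha => ?_
  simp [ha]

theorem isMinimalCover_unmatched {c : C} {s : S} {X Y : List (C ⊕ S)}
    (h : IsMinimalCover (unmatched (X ++ Sum.inl c :: Y)))
    (hc : c ∈ unmatched (X ++ Sum.inr s :: Y)) :
    IsMinimalCover (unmatched (X ++ Sum.inr s :: Y)) := by
  rw [unmatched_append_inl_cons] at h
  rw [unmatched_append_inr_cons] at hc ⊢
  obtain ⟨hall, u, a, hu, ha⟩ := h
  refine ⟨fun x => ?_, ?_⟩
  · have := hall x
    simp only [List.mem_append, List.mem_cons] at this hc ⊢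
    rcases this with h | rfl | h
    · exact Or.inl h
    · exact hc
    · exact Or.inr h
  · rcases List.eq_nil_or_concat (unmatched Y) with hY | ⟨Z, b, hY⟩
    · rw [hY] at hu hc
      obtain ⟨rfl, hca⟩ := List.append_inj' hu rfl
      rw [List.append_nil, (List.cons.inj hca).1] at hc
      exact absurd hc ha
    · rw [List.concat_eq_append] at hY
      rw [hY, ← List.cons_append, ← List.append_assoc] at hu
      obtain ⟨rfl, hba⟩ := List.append_inj' hu rfl
      refine ⟨unmatched X ++ Z, a, by rw [hY, hba, List.append_assoc], fun h' => ha ?_⟩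
      simp only [List.mem_append, List.mem_cons] at h' ⊢
      tauto

theorem nStep_Zbar (n : ℕ) {x y : List (C ⊕ S)} (hx : trimAug x = x)
    (hxc : IsMinimalCover (unmatched x)) (hyc : IsMinimalCover (unmatched y)) :
    nStep M.Zbar n x y = M.reachProb n x y := by
  induction n generalizing x with
  | zero =>
    rw [reachProb, wordSum_eq_nil _ (by simp +contextual), lineSum,
      wordSum_eq_nil]
    · simp [nStep, PMF.pure_apply, reaches, serveLine, hx, eq_comm]
    · intro l hl
      rw [reaches, if_neg]
      rw [serveLine, Option.map_some, Option.some_inj]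
      intro h
      have h' := congrArg unmatched h
      obtain ⟨-, u, a, hu, ha⟩ := hyc
      obtain ⟨l', b, rfl⟩ := (List.eq_nil_or_concat l).resolve_left hl
      rw [unmatched_trimAug, unmatched_append, unmatched_inl, hu, List.concat_eq_append,
        ← List.append_assoc] at h'
      obtain ⟨rfl, -⟩ := List.append_inj' h' rfl
      exact ha (List.mem_append_left _ (hxc.1 a))
  | succ n ih =>
    rw [nStep_succ, Zbar, expect_bind, reachProb, wordSum_eq]
    simp only [List.length_nil, (Nat.succ_ne_zero n).symm, if_false, zero_add, List.length_cons,
      Nat.add_right_cancel_iff]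
    refine expect_congr _ fun s _ => ?_
    rcases matchFirst_cases (fun c => (c, s) ∈ M.E) s x with ⟨h, -⟩ | ⟨X, c, Y, rfl, hc, hX, hw⟩
    · obtain ⟨c, hc, -⟩ := M.exists_compatible s
      exact absurd hc (h c (hxc.1 c))
    · rw [hw]
      dsimp only
      have hline : ∀ ss, lineSum M.α (X ++ Sum.inl c :: Y) (reaches M.E y (s :: ss)) =
          lineSum M.α (X ++ Sum.inr s :: Y) (reaches M.E y ss) := by
        intro ss
        refine wordSum_congr _ fun l => ?_
        rw [reaches_cons, List.append_assoc, List.cons_append,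
          matchFirst_append_cons (fun c => (c, s) ∈ M.E) _ _ hX hc]
        simp
      have htrim : ∀ w ss, lineSum M.α (trimAug w) (reaches M.E y ss) =
          lineSum M.α w (reaches M.E y ss) := fun w ss =>
        wordSum_congr _ fun l => reaches_trimAug M.E y ss w _
      simp only [hline]
      rw [expect_map]
      change (expect (if c ∈ unmatched (X ++ Sum.inr s :: Y) then _ else _) _) = _
      split_ifs with hcw
      · rw [expect_pure, ih (trimAug_trimAug _)
          (by rw [unmatched_trimAug]; exact isMinimalCover_unmatched hxc hcw), reachProb]
        simp only [htrim]
      · have hcover : ∀ w', M.revealUntil c (X ++ Sum.inr s :: Y) w' ≠ 0 →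
            IsMinimalCover (unmatched (trimAug w')) := by
          intro w' hw'
          rw [revealUntil, ← PMF.mem_support_iff, PMF.mem_support_map_iff] at hw'
          obtain ⟨l, hl, rfl⟩ := hw'
          have hcl : c ∉ l := by
            intro hcl
            rw [PMF.mem_support_iff, failures_apply, prod_map_failure,
              if_neg (fun h => h c hcl rfl), zero_mul] at hl
            exact hl rfl
          rw [unmatched_trimAug, unmatched_append, unmatched_append, unmatched_inl]
          refine ⟨fun a => ?_, _, c, rfl, fun h => ?_⟩
          · have := hxc.1 a
            rw [unmatched_append_inl_cons] at this
            rw [unmatched_append_inr_cons]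
            simp only [List.mem_append, List.mem_cons, unmatched_cons_inl, unmatched_nil] at this ⊢
            tauto
          · exact (List.mem_append.1 h).elim hcw hcl
        rw [expect_congr _ fun w' hw' => ih (trimAug_trimAug w') (hcover w' hw')]
        simp only [reachProb]
        rw [expect_wordSum]
        refine wordSum_congr _ fun ss => ?_
        split_ifs
        · simp only [htrim]
          refine M.expect_revealUntil c _ _ fun l hl => reaches_eq_zero M.E (hyc.1 c) ?_
          rw [unmatched_append, unmatched_inl, List.mem_append]
          exact fun h => h.elim hcw hl
        · exact expect_const _ _

/-! ### Comparison with the probabilities of a perfect matching -/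

/-- A return to a state whose exchanged servers are followed by the unmatched customers `u` only:
if the line after the exchanged servers begins with `u ++ l`, it has the form `l' ++ u`, where the
customers in `l'`, as many and as likely as those in `l`, are matched perfectly. -/
theorem reachProb_le (n : ℕ) (v : List S) (u : List C) :
    M.reachProb n (v.map Sum.inr ++ u.map Sum.inl) (v.map Sum.inr ++ u.map Sum.inl) ≤
      M.perfectProb n := by
  set x : List (C ⊕ S) := v.map Sum.inr ++ u.map Sum.inl with hx
  rw [perfectProb, wordSum_comm, reachProb]
  refine ENNReal.tsum_le_tsum fun ss => mul_le_mul_right ?_ _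
  by_cases hn : ss.length = n
  swap
  · simp [hn]
  simp only [hn, if_true, true_and]
  have key : ∀ l : List C, wordWeight M.α l * reaches M.E x ss (x ++ l.map Sum.inl) ≤
      ∑' l' : List C, if u ++ l = l' ++ u then
        wordWeight M.α l' * (if serve M.E ss l' = some [] then 1 else 0) else 0 := by
    intro l
    by_cases hr : (serveLine M.E ss (x ++ l.map Sum.inl)).map trimAug = some x
    swap
    · simp [reaches, hr]
    obtain ⟨W', hW', ht⟩ := Option.map_eq_some_iff.1 hr
    obtain ⟨p, hp, -⟩ := exists_eq_append_trimAug W'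
    rw [ht, hx, ← List.append_assoc, ← List.map_append] at hp
    rw [hp] at hW'
    obtain ⟨A, hA, hrun⟩ := exists_of_serveLine_eq_append M.E hW'
    have h1 : u ++ l = unmatched A ++ u := by
      have := congrArg unmatched hA
      simpa [hx, unmatched_append] using this
    have h2 : serve M.E ss (unmatched A) = some [] := by
      rw [serve_unmatched, hrun, Option.map_some, unmatched_inr]
    have h3 : wordWeight M.α l = wordWeight M.α (unmatched A) := by
      have := congrArg (wordWeight M.α) h1
      rw [wordWeight_append, wordWeight_append, mul_comm] at this
      exact (ENNReal.mul_left_inj (wordWeight_ne_zero M.α_ne_zero u)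
        (wordWeight_ne_top M.α u)).1 this
    refine le_trans ?_ (ENNReal.le_tsum (unmatched A))
    rw [if_pos h1, if_pos h2, reaches, if_pos hr, h3]
  refine (ENNReal.tsum_le_tsum key).trans ?_
  rw [ENNReal.tsum_comm]
  refine ENNReal.tsum_le_tsum fun l' => ?_
  by_cases h : ∃ l, u ++ l = l' ++ u
  · obtain ⟨l, hl⟩ := h
    rw [tsum_eq_single l]
    · rw [if_pos hl]
    · intro m hm
      rw [if_neg]
      intro hm'
      exact hm (List.append_cancel_left (hm'.trans hl.symm))
  · push Not at h
    simp [h]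

/-- To get from one perfect state to another, it is enough that first the known customers `u` are
matched, one by one, then there is a perfect matching of `n` customers and servers, and then the
servers in `v'` are matched, one by one, with customers followed by `u'`. -/
theorem exists_le_reachProb (v : List S) (u : List C) (t : S) (v' : List S) (u' : List C)
    (ht : t ∉ v') (hall : ∀ s, s ∈ t :: v') :
    ∃ δ ≠ 0, ∃ m, ∀ n, δ * M.perfectProb n ≤
      M.reachProb (m + n) (v.map Sum.inr ++ u.map Sum.inl)
        ((t :: v').map Sum.inr ++ u'.map Sum.inl) := by
  choose f hf using fun c => M.swap.exists_compatible c
  choose g hg using fun s => M.exists_compatible s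
  set ss₀ := u.map f with hss₀
  set V := t :: v' with hV
  set cs₁ := V.map g with hcs₁
  have h0 : List.Forall₂ (fun c s => (c, s) ∈ M.E) u ss₀ := by
    rw [hss₀, List.forall₂_map_right_iff, List.forall₂_same]
    exact fun c _ => (M.mem_swap_E _ _).1 (hf c).1
  have h1 : List.Forall₂ (fun c s => (c, s) ∈ M.E) cs₁ V := by
    rw [hcs₁, List.forall₂_map_left_iff, List.forall₂_same]
    exact fun s _ => (hg s).1
  set x : List (C ⊕ S) := v.map Sum.inr ++ u.map Sum.inl with hx
  set y : List (C ⊕ S) := V.map Sum.inr ++ u'.map Sum.inl with hy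
  refine ⟨wordWeight M.β ss₀ * wordWeight M.β V * wordWeight M.α (cs₁ ++ u'), ?_,
    ss₀.length + V.length, fun n => ?_⟩
  · exact mul_ne_zero (mul_ne_zero (wordWeight_ne_zero M.β_ne_zero _)
      (wordWeight_ne_zero M.β_ne_zero _)) (wordWeight_ne_zero M.α_ne_zero _)
  rw [reachProb]
  refine le_trans ?_ (le_wordSum M.β _ ss₀ V)
  rw [mul_assoc]
  gcongr
  rw [perfectProb, wordSum_comm, ← wordSum_mul_left]
  refine ENNReal.tsum_le_tsum fun ss => mul_le_mul_right ?_ _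
  by_cases hn : ss.length = n
  swap
  · simp [hn, wordSum_zero]
  dsimp only
  rw [if_pos (by simp only [List.length_append, hn]; omega), lineSum]
  refine le_trans ?_ (le_wordSum M.α _ [] (cs₁ ++ u'))
  rw [wordWeight_nil, one_mul]
  gcongr
  refine ENNReal.tsum_le_tsum fun cs => mul_le_mul_right ?_ _
  by_cases hs : serve M.E ss cs = some []
  swap
  · simp [hs]
  dsimp only
  rw [if_pos ⟨hn, hs⟩]
  obtain ⟨σ, hσ⟩ := exists_serveLine_of_serve M.E hs
  have hrun : serveLine M.E (ss₀ ++ (ss ++ V)) (x ++ (cs ++ (cs₁ ++ u')).map Sum.inl) =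
      some ((v ++ (ss₀ ++ σ)).map Sum.inr ++ y) := by
    rw [hx, List.append_assoc, serveLine_inr_append, serveLine_append,
      serveLine_append_line M.E _ (serveLine_of_forall₂ M.E h0), Option.bind_some,
      serveLine_inr_append, List.map_append, serveLine_append, serveLine_append_line M.E _ hσ,
      Option.bind_some, serveLine_inr_append, List.map_append,
      serveLine_append_line M.E _ (serveLine_of_forall₂ M.E h1)]
    simp [hy]
  rw [List.nil_append, reaches, if_pos]
  rw [hrun, Option.map_some, Option.some_inj, trimAug_inr_append]
  · rw [hy, hV, List.map_cons, List.cons_append, trimAug_cons_inr, if_neg]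
    rw [exchanged_append, exchanged_inr, exchanged_inl, List.append_nil]
    exact ht
  · intro b _
    rw [hy, exchanged_append, exchanged_inr]
    exact List.mem_append_left _ (hall b)

theorem perfectProb_zero : M.perfectProb 0 = 1 := by
  rw [← nStep_O]
  simp [nStep]

theorem perfectProb_one : M.perfectProb 1 ≠ 0 := by
  obtain ⟨s₀, -⟩ := M.β.support_nonempty
  obtain ⟨c, hc, -⟩ := M.exists_compatible s₀
  have h : wordWeight M.α [c] * (wordWeight M.β [s₀] * 1) ≤ M.perfectProb 1 := by
    refine le_trans (mul_le_mul_right ?_ _) (ENNReal.le_tsum [c])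
    refine le_trans (mul_le_mul_right (le_of_eq ?_) _) (ENNReal.le_tsum [s₀])
    simp [serve, hc]
  refine ne_bot_of_le_ne_bot ?_ h
  simp [M.α_ne_zero, M.β_ne_zero]

theorem trimAug_perfect {t : S} {v : List S} (ht : t ∉ v) (u : List C) :
    trimAug ((t :: v).map Sum.inr ++ u.map Sum.inl : List (C ⊕ S)) =
      (t :: v).map Sum.inr ++ u.map Sum.inl := by
  rw [List.map_cons, List.cons_append, trimAug_cons_inr, if_neg]
  rwa [exchanged_append, exchanged_inr, exchanged_inl, List.append_nil]

theorem isErgodicChain_Zaug_iff :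
    IsErgodicChain M.Zaug (perfectAug C S) ↔ LinearGrowth M.perfectProb := by
  obtain ⟨s₀, -⟩ := M.β.support_nonempty
  have : Nonempty S := ⟨s₀⟩
  have hnil : ∀ l : List (C ⊕ S), l = l ++ ([] : List C).map Sum.inl := by simp
  refine isErgodicChain_iff_of_comparable _ _ (by simp [perfectProb_zero]) M.perfectProb_one
    ?_ ?_ ?_
  · obtain ⟨t, v, h⟩ := exists_cons_cover (A := S)
    exact ⟨_, t, v, rfl, h⟩
  · rintro x ⟨t, v, rfl, ht, hall⟩ n
    have h := trimAug_perfect ht ([] : List C)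
    rw [← hnil] at h
    rw [nStep_Zaug M n h, hnil ((t :: v).map Sum.inr)]
    exact M.reachProb_le n _ _
  · rintro x ⟨t, v, rfl, ht, hall⟩ y ⟨t', v', rfl, ht', hall'⟩
    have h := trimAug_perfect ht ([] : List C)
    rw [← hnil] at h
    obtain ⟨δ, hδ, m, hm⟩ := M.exists_le_reachProb (t :: v) [] t' v' [] ht' hall'
    refine ⟨δ, hδ, m, fun n => ?_⟩
    rw [nStep_Zaug M _ h]
    simpa using hm n

theorem isErgodicChain_Zbar_iff :
    IsErgodicChain M.Zbar (perfectBar C S) ↔ LinearGrowth M.perfectProb := by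
  obtain ⟨s₀, -⟩ := M.β.support_nonempty
  obtain ⟨c₀, -⟩ := M.α.support_nonempty
  have : Nonempty S := ⟨s₀⟩
  have : Nonempty C := ⟨c₀⟩
  have hcover : ∀ (v : List S) (u : List C) (a : C), a ∉ u → (∀ c, c ∈ u ++ [a]) →
      IsMinimalCover (unmatched (v.map Sum.inr ++ (u ++ [a]).map Sum.inl)) := by
    intro v u a ha hc
    rw [unmatched_append, unmatched_inr, unmatched_inl, List.nil_append]
    exact ⟨hc, u, a, rfl, ha⟩
  refine isErgodicChain_iff_of_comparable _ _ (by simp [perfectProb_zero]) M.perfectProb_one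
    ?_ ?_ ?_
  · obtain ⟨t, v, ht, hall⟩ := exists_cons_cover (A := S)
    obtain ⟨a, u, ha, hc⟩ := exists_cons_cover (A := C)
    exact ⟨_, t, v, u, a, rfl, ht, hall, ha, fun c => by simpa [or_comm] using hc c⟩
  · rintro x ⟨t, v, u, a, rfl, ht, hall, ha, hc⟩ n
    rw [nStep_Zbar M n (trimAug_perfect ht _) (hcover _ u a ha hc) (hcover _ u a ha hc)]
    exact M.reachProb_le n _ _
  · rintro x ⟨t, v, u, a, rfl, ht, hall, ha, hc⟩ y ⟨t', v', u', a', rfl, ht', hall', ha', hc'⟩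
    obtain ⟨δ, hδ, m, hm⟩ :=
      M.exists_le_reachProb (t :: v) (u ++ [a]) t' v' (u' ++ [a']) ht' hall'
    refine ⟨δ, hδ, m, fun n => ?_⟩
    rw [nStep_Zbar M _ (trimAug_perfect ht _) (hcover _ u a ha hc) (hcover _ u' a' ha' hc')]
    exact hm n

end MatchingModel

/-! ### Necessity of complete resource pooling -/

namespace MatchingModel

variable {C S : Type*} [Fintype C] [DecidableEq C] [Fintype S] [DecidableEq S]
  (M : MatchingModel C S)

/-- If all servers that are compatible with a type in `A` are in `T`, then the number of unmatched
customers in `A` minus the number of unmatched servers in `T` grows at least as much as it would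
if no matches were made. -/
theorem countP_pairStep (A : Finset C) (T : Finset S)
    (hT : ∀ c ∈ A, ∀ s, (c, s) ∈ M.E → s ∈ T) (c : C) (s : S) (p : List C) (q : List S) :
    p.countP (· ∈ A) + (M.pairStep c s (p, q)).2.countP (· ∈ T) + [c].countP (· ∈ A) ≤
        (M.pairStep c s (p, q)).1.countP (· ∈ A) + q.countP (· ∈ T) + [s].countP (· ∈ T) ∧
      (M.pairStep c s (p, q)).1.countP (· ∈ A) ≤ p.countP (· ∈ A) + 1 ∧
      q.countP (· ∈ T) ≤ (M.pairStep c s (p, q)).2.countP (· ∈ T) + 1 := by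
  have hle : ∀ x y, (x, y) ∈ M.E → [x].countP (· ∈ A) ≤ [y].countP (· ∈ T) := by
    intro x y hxy
    rw [List.countP_singleton, List.countP_singleton]
    by_cases hx : x ∈ A
    · simp [hx, hT x hx y hxy]
    · simp [hx]
  have hA1 : ∀ x, [x].countP (· ∈ A) ≤ 1 := fun x => List.countP_le_length
  have hT1 : ∀ y, [y].countP (· ∈ T) ≤ 1 := fun y => List.countP_le_length
  have hconsA : ∀ x (l : List C), (x :: l).countP (· ∈ A) =
      [x].countP (· ∈ A) + l.countP (· ∈ A) := fun x l => List.countP_append (l₁ := [x])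
  have hconsT : ∀ y (l : List S), (y :: l).countP (· ∈ T) =
      [y].countP (· ∈ T) + l.countP (· ∈ T) := fun y l => List.countP_append (l₁ := [y])
  rw [pairStep]
  dsimp only
  by_cases hs : ∃ x ∈ p, (x, s) ∈ M.E
  · rw [if_pos hs]
    obtain ⟨p₁, x, p₂, rfl, hx, hp₁⟩ := exists_first (fun x => (x, s) ∈ M.E) hs
    rw [eraseP_append_cons (fun x => (x, s) ∈ M.E) hp₁ hx]
    have h1 := hle x s hx
    have h2 := hA1 c
    by_cases hc : ∃ y ∈ q, (c, y) ∈ M.E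
    · rw [if_pos hc]
      obtain ⟨q₁, y, q₂, rfl, hy, hq₁⟩ := exists_first (fun y => (c, y) ∈ M.E) hc
      rw [eraseP_append_cons (fun y => (c, y) ∈ M.E) hq₁ hy]
      have h3 := hle c y hy
      have h4 := hT1 y
      simp only [List.countP_append, hconsA x p₂, hconsT y q₂]
      omega
    · rw [if_neg hc]
      simp only [List.countP_append, hconsA x p₂]
      omega
  · rw [if_neg hs]
    have h2 := hA1 c
    by_cases hc : ∃ y ∈ q, (c, y) ∈ M.E
    · rw [if_pos hc]
      obtain ⟨q₁, y, q₂, rfl, hy, hq₁⟩ := exists_first (fun y => (c, y) ∈ M.E) hc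
      rw [eraseP_append_cons (fun y => (c, y) ∈ M.E) hq₁ hy]
      have h3 := hle c y hy
      have h4 := hT1 y
      simp only [List.countP_append, hconsT y q₂]
      omega
    · rw [if_neg hc]
      by_cases hcs : (c, s) ∈ M.E
      · rw [if_pos hcs]
        have h3 := hle c s hcs
        dsimp only
        omega
      · rw [if_neg hcs]
        simp only [List.countP_append]
        omega

theorem expect_countP {A : Type*} [Fintype A] [DecidableEq A] (p : PMF A) (T : Finset A) :
    (expect p fun a => (([a].countP (· ∈ T) : ℕ) : ℝ≥0∞)) = ∑ a ∈ T, p a := by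
  rw [expect, tsum_fintype, ← Finset.sum_filter_add_sum_filter_not Finset.univ (· ∈ T)]
  rw [Finset.sum_congr rfl (g := p) fun a ha => ?_,
    Finset.sum_eq_zero (s := Finset.univ.filter (· ∉ T)) fun a ha => ?_]
  · simp
  · simp [(Finset.mem_filter.1 ha).2]
  · simp [(Finset.mem_filter.1 ha).2]

theorem completeResourcePooling_of_linearGrowth (h : LinearGrowth M.perfectProb) :
    M.CompleteResourcePooling := by
  intro A hA hAu
  by_contra hlt
  rw [not_lt] at hlt
  set T := Finset.univ.filter (fun s => ∃ c ∈ A, (c, s) ∈ M.E) with hTdef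
  have hT : ∀ c ∈ A, ∀ s, (c, s) ∈ M.E → s ∈ T := fun c hc s hcs =>
    Finset.mem_filter.2 ⟨Finset.mem_univ s, c, hc, hcs⟩
  have hα1 : ∑ c, M.α c = 1 := by rw [← tsum_fintype (L := .unconditional _), M.α.tsum_coe]
  have hβ1 : ∑ s, M.β s = 1 := by rw [← tsum_fintype (L := .unconditional _), M.β.tsum_coe]
  have hAtop : ∑ c ∈ A, M.α c ≠ ∞ := ENNReal.sum_ne_top.2 fun c _ => M.α.apply_ne_top c
  obtain ⟨s₁, hs₁⟩ : ∃ s, s ∉ T := by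
    by_contra! hall
    obtain ⟨c₀, hc₀⟩ : ∃ c, c ∉ A := by
      by_contra! hall'
      exact hAu (Finset.eq_univ_of_forall hall')
    have h1 : M.α c₀ + ∑ c ∈ A, M.α c ≤ 1 := by
      rw [← Finset.sum_insert hc₀, ← hα1]
      exact Finset.sum_le_sum_of_subset (Finset.subset_univ _)
    rw [Finset.eq_univ_of_forall hall, hβ1] at hlt
    have h2 : M.α c₀ + ∑ c ∈ A, M.α c ≤ 0 + ∑ c ∈ A, M.α c := by
      rw [zero_add]
      exact h1.trans hlt
    exact M.α_ne_zero c₀ (nonpos_iff_eq_zero.1 ((ENNReal.add_le_add_iff_right hAtop).1 h2))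
  obtain ⟨c₁, hc₁⟩ := hA
  let f : List C × List S → ℝ≥0∞ := fun o =>
    ((o.1.countP (· ∈ A) - o.2.countP (· ∈ T) : ℕ) : ℝ≥0∞)
  have hexp : ∀ o, expect (M.O o) f =
      expect M.α fun c => expect M.β fun s => f (M.pairStep c s o) := by
    intro o
    simp only [O, expect_bind, expect_pure]
  have htop : meanReturnTime M.O ([], []) = ∞ := by
    refine meanReturnTime_eq_top_of_submartingale M.O f (by simp [f]) 2 ?_ ?_ ?_
    · rintro ⟨p, q⟩ z hz
      rw [O, ← PMF.mem_support_iff, PMF.mem_support_bind_iff] at hz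
      obtain ⟨c, -, hz⟩ := hz
      rw [PMF.mem_support_bind_iff] at hz
      obtain ⟨s, -, hz⟩ := hz
      rw [PMF.mem_support_pure_iff] at hz
      obtain ⟨-, h2, h3⟩ := M.countP_pairStep A T hT c s p q
      rw [← hz] at h2 h3
      simp only [f]
      norm_cast
      omega
    · rintro ⟨p, q⟩
      rw [hexp]
      by_cases hpq : p.countP (· ∈ A) ≤ q.countP (· ∈ T)
      · have h0 : f (p, q) = 0 := by
          simp only [f]
          rw [Nat.sub_eq_zero_of_le hpq, Nat.cast_zero]
        rw [h0]
        exact zero_le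
      · have hstep : ∀ c s, f (p, q) + (([c].countP (· ∈ A) : ℕ) : ℝ≥0∞) ≤
            f (M.pairStep c s (p, q)) + (([s].countP (· ∈ T) : ℕ) : ℝ≥0∞) := by
          intro c s
          obtain ⟨h1, -, -⟩ := M.countP_pairStep A T hT c s p q
          simp only [f]
          norm_cast
          omega
        have h1 : f (p, q) + ∑ c ∈ A, M.α c ≤
            (expect M.α fun c => expect M.β fun s => f (M.pairStep c s (p, q))) +
              ∑ s ∈ T, M.β s := by
          have := expect_mono M.α fun c _ => expect_mono M.β fun s _ => hstep c s
          simpa only [expect_add, expect_const, expect_countP] using this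
        exact (ENNReal.add_le_add_iff_right hAtop).1 (h1.trans (by gcongr))
    · rw [hexp]
      have h1 : (1 : ℝ≥0∞) ≤ f (M.pairStep c₁ s₁ ([], [])) := by
        obtain ⟨h1, -, -⟩ := M.countP_pairStep A T hT c₁ s₁ [] []
        simp only [List.countP_singleton, List.countP_nil, hc₁, hs₁, decide_true, if_true,
          decide_false, Bool.false_eq_true, if_false] at h1
        simp only [f]
        norm_cast
        omega
      refine ne_bot_of_le_ne_bot (mul_ne_zero (M.α_ne_zero c₁) (M.β_ne_zero s₁)) ?_
      refine le_trans ?_ (mul_le_expect M.α _ c₁)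
      gcongr
      refine le_trans ?_ (mul_le_expect M.β _ s₁)
      exact le_mul_of_one_le_right' h1
  refine (meanReturnTime_ne_top_iff M.O ([], [])).2 ?_ htop
  simpa only [nStep_O] using h

end MatchingModel

/-! ### Sufficiency of complete resource pooling -/

section SplitSum

variable {A : Type*}

open Classical in
/-- The sum of `G` over all ways to split the word `y` into two parts. -/
noncomputable def splitSum (G : List A → List A → ℝ≥0∞) (y : List A) : ℝ≥0∞ :=
  ∑' l, ∑' m, if l ++ m = y then G l m else 0

theorem tsum_tsum_eq_splitSum (G : List A → List A → ℝ≥0∞) (f : List A → ℝ≥0∞) :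
    ∑' l, ∑' m, G l m * f (l ++ m) = ∑' y, splitSum G y * f y := by
  classical
  simp only [splitSum, ← ENNReal.tsum_mul_right]
  refine Eq.trans (tsum_congr fun l => ?_) ENNReal.tsum_comm
  refine Eq.trans (tsum_congr fun m => ?_) ENNReal.tsum_comm
  rw [tsum_eq_single (l ++ m)]
  · simp
  · intro y hy
    simp [hy.symm]

theorem splitSum_nil (G : List A → List A → ℝ≥0∞) : splitSum G [] = G [] [] := by
  classical
  rw [splitSum, tsum_eq_single [], tsum_eq_single []]
  · simp
  · intro m hm
    simp [hm]
  · intro l hl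
    simp [hl]

theorem splitSum_cons (G : List A → List A → ℝ≥0∞) (d : A) (y : List A) :
    splitSum G (d :: y) = G [] (d :: y) + splitSum (fun l m => G (d :: l) m) y := by
  classical
  rw [splitSum, tsum_list_eq]
  congr 1
  · rw [tsum_eq_single (d :: y)]
    · simp
    · intro m hm
      simp [hm]
  · rw [tsum_eq_single d]
    · simp [splitSum]
    · intro a ha
      simp [ha]

theorem splitSum_congr {G H : List A → List A → ℝ≥0∞} {y : List A}
    (h : ∀ l m, l ++ m = y → G l m = H l m) : splitSum G y = splitSum H y := by
  classical
  refine tsum_congr fun l => tsum_congr fun m => ?_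
  split_ifs with hy
  · exact h l m hy
  · rfl

theorem splitSum_mul_left (k : ℝ≥0∞) (G : List A → List A → ℝ≥0∞) (y : List A) :
    splitSum (fun l m => k * G l m) y = k * splitSum G y := by
  simp only [splitSum, ← ENNReal.tsum_mul_left, mul_ite, mul_zero]

theorem sum_splitSum {ι : Type*} (s : Finset ι) (G : ι → List A → List A → ℝ≥0∞) (y : List A) :
    ∑ i ∈ s, splitSum (G i) y = splitSum (fun l m => ∑ i ∈ s, G i l m) y := by
  classical
  induction s using Finset.induction_on with
  | empty => simp [splitSum]
  | insert i s hi ih =>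
    rw [Finset.sum_insert hi, ih]
    simp only [splitSum]
    rw [← ENNReal.tsum_add]
    refine tsum_congr fun l => ?_
    rw [← ENNReal.tsum_add]
    refine tsum_congr fun m => ?_
    split_ifs
    · rw [Finset.sum_insert hi]
    · rw [add_zero]

end SplitSum

namespace MatchingModel

variable {C S : Type*} [Fintype C] [DecidableEq C] [Fintype S] [DecidableEq S]
  (M : MatchingModel C S)

/-- The probability `β(S(A))` that a server is compatible with some type in `A`. -/
noncomputable def served (A : Finset C) : ℝ≥0∞ :=
  ∑ s, if ∃ c ∈ A, (c, s) ∈ M.E then M.β s else 0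

/-- The probability `1 - β(S(A))` that a server is not compatible with any type in `A`. -/
noncomputable def unserved (A : Finset C) : ℝ≥0∞ :=
  ∑ s, if ∃ c ∈ A, (c, s) ∈ M.E then 0 else M.β s

/-- The probability `β(S(A ∪ {c})) - β(S(A))`. -/
noncomputable def servedOnly (A : Finset C) (c : C) : ℝ≥0∞ :=
  ∑ s, if (∀ x ∈ A, (x, s) ∉ M.E) ∧ (c, s) ∈ M.E then M.β s else 0

theorem unserved_add_served (A : Finset C) : M.unserved A + M.served A = 1 := by
  rw [unserved, served, ← Finset.sum_add_distrib, ← M.β.tsum_coe, tsum_fintype]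
  refine Finset.sum_congr rfl fun s _ => ?_
  split_ifs <;> simp

theorem served_insert (A : Finset C) (c : C) :
    M.served (insert c A) = M.servedOnly A c + M.served A := by
  rw [served, servedOnly, served, ← Finset.sum_add_distrib]
  refine Finset.sum_congr rfl fun s _ => ?_
  by_cases h : ∃ x ∈ A, (x, s) ∈ M.E
  · have h' : ¬ ∀ x ∈ A, (x, s) ∉ M.E := by push Not; exact h
    have h'' : ∃ x ∈ insert c A, (x, s) ∈ M.E := by
      obtain ⟨x, hx, hxs⟩ := h
      exact ⟨x, Finset.mem_insert_of_mem hx, hxs⟩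
    rw [if_pos h'', if_pos h, if_neg (fun h => h' h.1), zero_add]
  · rw [if_neg h, add_zero]
    push Not at h
    refine if_congr ⟨?_, fun hc => ⟨c, Finset.mem_insert_self c A, hc.2⟩⟩ rfl rfl
    rintro ⟨x, hx, hxs⟩
    rcases Finset.mem_insert.1 hx with rfl | hx
    · exact ⟨h, hxs⟩
    · exact absurd hxs (h x hx)

theorem served_insert_ne_zero (A : Finset C) (c : C) : M.served (insert c A) ≠ 0 := by
  obtain ⟨s, hs, -⟩ := M.swap.exists_compatible c
  intro h
  rw [served, Finset.sum_eq_zero_iff] at h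
  have := h s (Finset.mem_univ s)
  rw [if_pos ⟨c, Finset.mem_insert_self c A, (M.mem_swap_E c s).1 hs⟩] at this
  exact M.β_ne_zero s this

theorem served_ne_top (A : Finset C) : M.served A ≠ ∞ := by
  intro h
  have := M.unserved_add_served A
  simp [h] at this

theorem served_empty : M.served ∅ = 0 := by simp [served]

/-- The product of the factors `α(cᵢ) / β(S(A ∪ {c₁, …, cᵢ}))` of the word `c₁ … cₙ`. -/
noncomputable def productForm (A : Finset C) : List C → ℝ≥0∞
  | [] => 1
  | c :: q => M.α c / M.served (insert c A) * productForm (insert c A) q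

theorem served_mul_productForm (A : Finset C) (c : C) (q : List C) :
    M.served (insert c A) * M.productForm A (c :: q) = M.α c * M.productForm (insert c A) q := by
  rw [productForm, ← mul_assoc, ENNReal.mul_div_cancel (M.served_insert_ne_zero A c)
    (M.served_ne_top _)]

theorem union_toFinset_cons (A : Finset C) (d : C) (l : List C) :
    A ∪ (d :: l).toFinset = insert d A ∪ l.toFinset := by
  rw [List.toFinset_cons, Finset.union_insert, Finset.insert_union]

/-- The balance of the insertions of a customer of type `c`. -/
theorem splitSum_insert (c : C) (q : List C) (A : Finset C) :
    splitSum (fun l m => M.productForm A (l ++ c :: m) * M.servedOnly (A ∪ l.toFinset) c) q +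
      M.served A * M.productForm A (c :: q) = M.α c * M.productForm A q := by
  induction q generalizing A with
  | nil =>
    rw [splitSum_nil, List.nil_append, List.toFinset_nil, Finset.union_empty, mul_comm, ← add_mul,
      ← served_insert, served_mul_productForm]
    rfl
  | cons d q ih =>
    have h1 : splitSum (fun l m => M.productForm A (d :: l ++ c :: m) *
        M.servedOnly (A ∪ (d :: l).toFinset) c) q = M.α d / M.served (insert d A) *
          splitSum (fun l m => M.productForm (insert d A) (l ++ c :: m) *
            M.servedOnly (insert d A ∪ l.toFinset) c) q := by
      rw [← splitSum_mul_left]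
      refine splitSum_congr fun l m _ => ?_
      rw [union_toFinset_cons, List.cons_append, productForm, mul_assoc]
    have h2 : M.servedOnly A c * M.productForm A (c :: d :: q) +
        M.served A * M.productForm A (c :: d :: q) =
        M.α d / M.served (insert d A) *
          (M.served (insert d A) * M.productForm (insert d A) (c :: q)) := by
      rw [← add_mul, ← served_insert, served_mul_productForm, ← mul_assoc,
        ENNReal.div_mul_cancel (M.served_insert_ne_zero A d) (M.served_ne_top _), productForm,
        productForm, Finset.insert_comm d c A]
      simp only [div_eq_mul_inv]
      ring
    rw [splitSum_cons, h1, List.nil_append, List.toFinset_nil, Finset.union_empty, add_right_comm,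
      mul_comm (M.productForm A _), h2, ← mul_add, add_comm, ih,
      productForm]
    ring

/-- The balance of the extensions by skipped customers. -/
theorem splitSum_skip (q : List C) (A : Finset C) :
    splitSum (fun l m => M.productForm A l * M.unserved (A ∪ l.toFinset) * wordWeight M.α m) q +
      M.served A * wordWeight M.α q = M.productForm A q := by
  induction q generalizing A with
  | nil =>
    rw [splitSum_nil]
    simp [productForm, unserved_add_served]
  | cons d q ih =>
    have h1 : splitSum (fun l m => M.productForm A (d :: l) *
        M.unserved (A ∪ (d :: l).toFinset) * wordWeight M.α m) q =
        M.α d / M.served (insert d A) * splitSum (fun l m => M.productForm (insert d A) l *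
          M.unserved (insert d A ∪ l.toFinset) * wordWeight M.α m) q := by
      rw [← splitSum_mul_left]
      refine splitSum_congr fun l m _ => ?_
      rw [union_toFinset_cons, productForm]
      simp only [mul_assoc]
    have h2 : wordWeight M.α (d :: q) = M.α d / M.served (insert d A) *
        (M.served (insert d A) * wordWeight M.α q) := by
      rw [← mul_assoc, ENNReal.div_mul_cancel (M.served_insert_ne_zero A d) (M.served_ne_top _),
        wordWeight_cons]
    rw [splitSum_cons, h1, List.toFinset_nil, Finset.union_empty, add_right_comm, productForm,
      one_mul, ← add_mul, unserved_add_served, one_mul, h2, ← mul_add, add_comm, ih, productForm]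

/-- The stationary measure of the chain of server by server matching. -/
noncomputable def stationaryWeight (q : List C) : ℝ≥0∞ :=
  M.productForm ∅ q * M.unserved q.toFinset

/-- The flow into `y` by removals of a customer of type `a`. -/
theorem sum_splitSum_removed (a : C) (y : List C) :
    ∑ s, M.β s * splitSum (fun l m => if (∀ x ∈ l, (x, s) ∉ M.E) ∧ (a, s) ∈ M.E then
      M.stationaryWeight (l ++ a :: m) else 0) y =
      M.unserved (insert a y.toFinset) * (M.α a * M.productForm ∅ y) := by
  have h := M.splitSum_insert a y ∅
  rw [served_empty, zero_mul, add_zero] at h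
  simp only [← h, ← splitSum_mul_left, sum_splitSum]
  refine splitSum_congr fun l m hy => ?_
  have hset : (l ++ a :: m).toFinset = insert a y.toFinset := by
    rw [← hy]
    ext x
    simp only [List.mem_toFinset, List.mem_append, List.mem_cons, Finset.mem_insert]
    tauto
  rw [Finset.empty_union, servedOnly, Finset.mul_sum, Finset.mul_sum]
  refine Finset.sum_congr rfl fun s _ => ?_
  rw [stationaryWeight, hset]
  simp only [List.mem_toFinset]
  split_ifs
  · ring
  · simp

/-- The flow into `y` by extensions, for servers of type `s`. -/
theorem splitSum_skipped (s : S) (y : List C) (k : ℝ≥0∞) :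
    splitSum (fun l m => if ∃ c ∈ l, (c, s) ∈ M.E then 0 else M.stationaryWeight l *
      ((if ∀ x ∈ m, (x, s) ∉ M.E then wordWeight M.α m else 0) * k)) y =
      if ∃ c ∈ y, (c, s) ∈ M.E then 0 else k * M.productForm ∅ y := by
  have h := M.splitSum_skip y ∅
  rw [served_empty, zero_mul, add_zero] at h
  simp only [Finset.empty_union] at h
  split_ifs with hy
  · refine (splitSum_congr (H := fun _ _ => 0) fun l m hlm => ?_).trans (by simp [splitSum])
    split_ifs with h1 h2
    · rfl
    · obtain ⟨c, hc, hcs⟩ := hy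
      rw [← hlm, List.mem_append] at hc
      exact (hc.elim (fun hc => h1 ⟨c, hc, hcs⟩) fun hc => h2 c hc hcs).elim
    · simp
  · rw [← h, ← splitSum_mul_left]
    push Not at hy
    refine splitSum_congr fun l m hlm => ?_
    rw [if_neg, if_pos, stationaryWeight]
    · ring
    · exact fun x hx => hy x (by simp [← hlm, hx])
    · rintro ⟨x, hx, hxs⟩
      exact hy x (by simp [← hlm, hx]) hxs

/-- The weights `stationaryWeight` are stationary for server by server matching. -/
theorem tsum_stationaryWeight_mul_expect (f : List C → ℝ≥0∞) :
    ∑' q, M.stationaryWeight q * expect (M.Qs q) f = ∑' y, M.stationaryWeight y * f y := by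
  have hs : ∀ s, ∑' q, M.stationaryWeight q *
      (if ∃ c ∈ q, (c, s) ∈ M.E then f (q.eraseP fun c => (c, s) ∈ M.E)
        else expect (M.skipped s) fun l => f (q ++ l)) =
      ∑' y, ((∑ a, splitSum (fun l m => if (∀ x ∈ l, (x, s) ∉ M.E) ∧ (a, s) ∈ M.E then
          M.stationaryWeight (l ++ a :: m) else 0) y) +
        splitSum (fun l m => if ∃ c ∈ l, (c, s) ∈ M.E then 0 else M.stationaryWeight l *
          ((if ∀ x ∈ m, (x, s) ∉ M.E then wordWeight M.α m else 0) *
            ∑ a, if (a, s) ∈ M.E then M.α a else 0)) y) * f y := by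
    intro s
    simp only [add_mul, ENNReal.tsum_add]
    rw [← tsum_tsum_eq_splitSum]
    have h1 : ∑' y, (∑ a, splitSum (fun l m => if (∀ x ∈ l, (x, s) ∉ M.E) ∧ (a, s) ∈ M.E then
        M.stationaryWeight (l ++ a :: m) else 0) y) * f y =
        ∑' q, if ∃ c ∈ q, (c, s) ∈ M.E then
          M.stationaryWeight q * f (q.eraseP fun c => (c, s) ∈ M.E) else 0 := by
      rw [tsum_list_split (fun c => (c, s) ∈ M.E) _ fun l hl => if_neg (by push Not; exact hl)]
      simp only [sum_splitSum]
      rw [← tsum_tsum_eq_splitSum]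
      refine tsum_congr fun l => ?_
      rw [ENNReal.tsum_comm]
      refine tsum_congr fun m => ?_
      rw [tsum_fintype, Finset.sum_mul]
      refine Finset.sum_congr rfl fun a _ => ?_
      by_cases h : (∀ x ∈ l, (x, s) ∉ M.E) ∧ (a, s) ∈ M.E
      · rw [if_pos h, if_pos h, if_pos ⟨a, by simp, h.2⟩,
          eraseP_append_cons (fun c => (c, s) ∈ M.E) h.1 h.2]
      · rw [if_neg h, if_neg h, zero_mul]
    rw [h1, ← ENNReal.tsum_add]
    refine tsum_congr fun q => ?_
    by_cases hq : ∃ c ∈ q, (c, s) ∈ M.E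
    · simp only [if_pos hq, zero_mul, tsum_zero, add_zero]
    · simp only [if_neg hq, zero_add]
      rw [expect, ← ENNReal.tsum_mul_left]
      refine tsum_congr fun l => ?_
      rw [skipped, failures_apply, prod_map_failure, ← mul_assoc]
      congr!
  simp only [splitSum_skipped] at hs
  have hexp : ∀ q, expect (M.Qs q) f = ∑ s, M.β s *
      (if ∃ c ∈ q, (c, s) ∈ M.E then f (q.eraseP fun c => (c, s) ∈ M.E)
        else expect (M.skipped s) fun l => f (q ++ l)) := by
    intro q
    rw [Qs, expect_bind, expect, tsum_fintype]
    refine Finset.sum_congr rfl fun s _ => ?_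
    split_ifs
    · rw [expect_pure]
    · rw [expect_map]
  simp only [hexp, Finset.mul_sum]
  rw [Summable.tsum_finsetSum fun s _ => ENNReal.summable]
  simp only [mul_left_comm _ (M.β _), ENNReal.tsum_mul_left, hs]
  simp only [← ENNReal.tsum_mul_left]
  rw [← Summable.tsum_finsetSum fun s _ => ENNReal.summable]
  refine tsum_congr fun y => ?_
  simp only [← mul_assoc, ← Finset.sum_mul]
  congr 1
  simp only [mul_add, Finset.mul_sum, Finset.sum_add_distrib]
  rw [Finset.sum_comm]
  simp only [sum_splitSum_removed]
  simp only [unserved, Finset.sum_mul]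
  rw [Finset.sum_comm, ← Finset.sum_add_distrib, stationaryWeight, unserved, Finset.mul_sum]
  refine Finset.sum_congr rfl fun s _ => ?_
  by_cases hy : ∃ c ∈ y, (c, s) ∈ M.E
  · have h2 : ∀ a, ∃ c ∈ insert a y.toFinset, (c, s) ∈ M.E := by
      intro a
      obtain ⟨c, hc, hcs⟩ := hy
      exact ⟨c, by simp [hc], hcs⟩
    have h3 : ∃ c ∈ y.toFinset, (c, s) ∈ M.E := by simpa using hy
    rw [if_pos hy, if_pos h3, mul_zero, mul_zero, add_zero]
    exact Finset.sum_eq_zero fun a _ => by rw [if_pos (h2 a), zero_mul]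
  · have h3 : ¬ ∃ c ∈ y.toFinset, (c, s) ∈ M.E := by simpa using hy
    rw [if_neg hy, if_neg h3, Finset.mul_sum, ← Finset.sum_add_distrib]
    have h4 : ∀ a, (∃ c ∈ insert a y.toFinset, (c, s) ∈ M.E) ↔ (a, s) ∈ M.E := by
      intro a
      rw [Finset.exists_mem_insert, or_iff_left h3]
    have h5 : ∑ a, M.α a = 1 := by rw [← tsum_fintype (L := .unconditional _), M.α.tsum_coe]
    rw [← mul_one (M.productForm ∅ y * M.β s), ← h5, Finset.mul_sum]
    refine Finset.sum_congr rfl fun a _ => ?_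
    simp only [h4]
    split_ifs <;> ring

/-- The total weight of the words of length less than `n` that follow a set `A` of types is bounded:
by complete resource pooling, the repetitions of types in `A` make up a convergent geometric
series, and there are only finitely many new types. -/
theorem exists_tsum_le (h : M.CompleteResourcePooling) (A : Finset C) :
    ∃ B ≠ ∞, ∀ n, (∑' q : List C, if q.length < n then
      M.productForm A q * M.unserved (A ∪ q.toFinset) else 0) ≤ B := by
  induction A using WellFoundedGT.induction with
  | ind A ih =>
    by_cases hA : A = Finset.univ
    · refine ⟨0, by simp, fun n => le_of_eq ?_⟩
      have h0 : M.unserved Finset.univ = 0 := by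
        refine Finset.sum_eq_zero fun s _ => ?_
        obtain ⟨c, hc, -⟩ := M.exists_compatible s
        rw [if_pos ⟨c, Finset.mem_univ c, hc⟩]
      rw [ENNReal.tsum_eq_zero]
      intro q
      rw [hA, Finset.union_eq_left.2 (Finset.subset_univ _), h0, mul_zero, ite_self]
    · set m : ℕ → Finset C → ℝ≥0∞ := fun n A => ∑' q : List C, if q.length < n then
        M.productForm A q * M.unserved (A ∪ q.toFinset) else 0 with hm
      have hrec : ∀ n, m (n + 1) A = M.unserved A +
          ∑ c, M.α c / M.served (insert c A) * m n (insert c A) := by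
        intro n
        simp only [hm]
        rw [tsum_list_eq, tsum_fintype]
        congr 1
        · simp [productForm]
        · refine Finset.sum_congr rfl fun c _ => ?_
          rw [← ENNReal.tsum_mul_left]
          refine tsum_congr fun q => ?_
          simp only [List.length_cons, Nat.add_lt_add_iff_right, union_toFinset_cons, productForm,
            mul_assoc, mul_ite, mul_zero]
      have hB : ∀ c, ∃ B, c ∉ A → B ≠ ∞ ∧ ∀ n, m n (insert c A) ≤ B := by
        intro c
        by_cases hc : c ∈ A
        · exact ⟨0, fun h => absurd hc h⟩
        · obtain ⟨B, hB, hB'⟩ := ih (insert c A) (Finset.ssubset_insert hc)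
          exact ⟨B, fun _ => ⟨hB, hB'⟩⟩
      choose B hB using hB
      set K := M.unserved A + ∑ c ∈ Aᶜ, M.α c / M.served (insert c A) * B c with hK
      set ρ := (∑ c ∈ A, M.α c) / M.served A with hρ
      have hρ1 : ρ < 1 := by
        rcases A.eq_empty_or_nonempty with rfl | hne
        · simp [hρ]
        · have := h A hne hA
          rw [Finset.sum_filter] at this
          exact (ENNReal.div_lt_iff (Or.inl (ne_bot_of_gt this))
            (Or.inl (M.served_ne_top A))).2 (by rw [one_mul]; exact this)
      have hKtop : K ≠ ∞ := by
        refine ENNReal.add_ne_top.2 ⟨fun ht => ?_, ENNReal.sum_ne_top.2 fun c hc => ?_⟩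
        · have := M.unserved_add_served A
          simp [ht] at this
        · exact ENNReal.mul_ne_top (ENNReal.div_ne_top (M.α.apply_ne_top c)
            (M.served_insert_ne_zero A c)) (hB c (Finset.mem_compl.1 hc)).1
      have hstep : ∀ n, m (n + 1) A ≤ K + ρ * m n A := by
        intro n
        rw [hrec, hK, ← Finset.sum_add_sum_compl A, add_comm (∑ c ∈ A, _), ← add_assoc]
        refine add_le_add (add_le_add le_rfl (Finset.sum_le_sum fun c hc => ?_)) (le_of_eq ?_)
        · gcongr
          exact (hB c (Finset.mem_compl.1 hc)).2 n
        · rw [hρ, div_eq_mul_inv, Finset.sum_mul, Finset.sum_mul]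
          refine Finset.sum_congr rfl fun c hc => ?_
          rw [Finset.insert_eq_of_mem hc, div_eq_mul_inv]
      have hinv : (1 - ρ) * (1 - ρ)⁻¹ = 1 := ENNReal.mul_inv_cancel
        (tsub_pos_of_lt hρ1).ne' (ne_top_of_le_ne_top (by simp) tsub_le_self)
      refine ⟨K * (1 - ρ)⁻¹, ENNReal.mul_ne_top hKtop
        (ENNReal.inv_ne_top.2 (tsub_pos_of_lt hρ1).ne'), fun n => ?_⟩
      change m n A ≤ _
      induction n with
      | zero => simp [hm]
      | succ n ihn =>
        calc m (n + 1) A ≤ K + ρ * m n A := hstep n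
          _ ≤ K + ρ * (K * (1 - ρ)⁻¹) := by gcongr
          _ = K * ((1 - ρ) * (1 - ρ)⁻¹ + ρ * (1 - ρ)⁻¹) := by rw [hinv]; ring
          _ = K * (1 - ρ)⁻¹ := by
            rw [← add_mul, tsub_add_cancel_of_le hρ1.le, one_mul]

theorem tsum_stationaryWeight_ne_top (h : M.CompleteResourcePooling) :
    ∑' q, M.stationaryWeight q ≠ ∞ := by
  obtain ⟨B, hB, hle⟩ := M.exists_tsum_le h ∅
  refine ne_top_of_le_ne_top hB ?_
  rw [ENNReal.tsum_eq_iSup_sum]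
  refine iSup_le fun s => ?_
  refine le_trans ?_ ((ENNReal.sum_le_tsum s).trans (hle (s.sup List.length + 1)))
  refine Finset.sum_le_sum fun q hq => ?_
  rw [if_pos (Nat.lt_succ_of_le (Finset.le_sup (f := List.length) hq)), Finset.empty_union]
  rfl

theorem linearGrowth_of_completeResourcePooling (h : M.CompleteResourcePooling) :
    LinearGrowth M.perfectProb := by
  have h1 : M.stationaryWeight [] ≠ 0 := by
    have := M.unserved_add_served ∅
    rw [served_empty, add_zero] at this
    simp [stationaryWeight, productForm, this]
  have h2 := meanReturnTime_ne_top_of_subinvariant M.Qs M.stationaryWeight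
    (M.tsum_stationaryWeight_ne_top h) (fun f => (M.tsum_stationaryWeight_mul_expect f).le) h1
  rw [meanReturnTime_ne_top_iff] at h2
  simpa only [nStep_Qs] using h2

theorem linearGrowth_iff : LinearGrowth M.perfectProb ↔ M.CompleteResourcePooling :=
  ⟨M.completeResourcePooling_of_linearGrowth, M.linearGrowth_of_completeResourcePooling⟩

end MatchingModel

/-! ### The nine chains -/

theorem mainTheorem9 {C S : Type*} [Fintype C] [DecidableEq C] [Fintype S] [DecidableEq S]
    (M : MatchingModel C S) :
    -- the natural chains: pair by pair, server by server, customer by customer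
    (IsErgodicChain M.O {([], [])} ↔ M.CompleteResourcePooling) ∧
    (IsErgodicChain M.Qs {[]} ↔ M.CompleteResourcePooling) ∧
    (IsErgodicChain M.Qc {[]} ↔ M.CompleteResourcePooling) ∧
    -- the detailed chains: server by server, customer by customer, backward and forward pairs
    (IsErgodicChain M.Zs {[]} ↔ M.CompleteResourcePooling) ∧
    (IsErgodicChain M.Zc {[]} ↔ M.CompleteResourcePooling) ∧
    (IsErgodicChain M.D {([], [])} ↔ M.CompleteResourcePooling) ∧
    (IsErgodicChain M.forward {([], [])} ↔ M.CompleteResourcePooling) ∧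
    -- the augmented chains
    (IsErgodicChain M.Zaug (MatchingModel.perfectAug C S) ↔ M.CompleteResourcePooling) ∧
    (IsErgodicChain M.Zbar (MatchingModel.perfectBar C S) ↔ M.CompleteResourcePooling) := by
  rw [← M.linearGrowth_iff]
  have hswap : M.swap.perfectProb = M.perfectProb := funext M.perfectProb_swap
  refine ⟨?_, ?_, ?_, ?_, ?_, ?_, ?_, M.isErgodicChain_Zaug_iff, M.isErgodicChain_Zbar_iff⟩
  · exact isErgodicChain_singleton_iff _ _ M.perfectProb_one M.nStep_O
  · exact isErgodicChain_singleton_iff _ _ M.perfectProb_one M.nStep_Qs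
  · rw [← hswap]
    exact isErgodicChain_singleton_iff _ _ M.swap.perfectProb_one M.swap.nStep_Qs
  · exact isErgodicChain_singleton_iff _ _ M.perfectProb_one M.nStep_Zs
  · rw [← hswap]
    exact isErgodicChain_singleton_iff _ _ M.swap.perfectProb_one M.swap.nStep_Zs
  · exact isErgodicChain_singleton_iff _ _ M.perfectProb_one M.nStep_D
  · exact isErgodicChain_singleton_iff _ _ M.perfectProb_one M.nStep_forward
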